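/- There is a deterministic Real RAM program and a constant $C$ such that the following holds for every $n \ge 0$ and every set $P \subset \mathbb{R}^2$ of $n$ points that is in general position (no three distinct points of $P$ are collinear) and in which no two points share an $x$-coordinate. Given an array $A_x$ of length $n$ that stores $P$ sorted by $x$-coordinate, the program halts after at most $C(n+1)$ steps, that is, in linear time, and its output is a triangulation of $P$. Here a *triangulation* of $P$ is a geometric simplicial complex in the plane whose vertex set is exactly $P$ and whose underlying space is the convex hull of $P$. It is output as the list of its edges and the list of its triangles, each edge and each triangle occurring exactly once, as a pair or triple of indices into $A_x$. The *Real RAM* is a random access machine in which each memory cell is designated to hold an integer or a real number. A program is a finite sequence of instructions, each of unit cost: writing an integer constant; $+,-,\times$ on integers, with an integer result; $+,-,\times,/$ on numbers of either kind, with a real result; comparisons $=,<$, whose Boolean result is stored as an integer; a jump that is conditional on a Boolean; and halting. Cells are addressed directly, or indirectly through an integer cell. There is no integer division, and a real number cannot be written to an integer cell. Initially the first $2n$ real cells hold the coordinates of $A_x[0], A_x[1], \ldots, A_x[n-1]$ in order, the first integer cell holds $n$, and all other cells hold $0$. The output is the integer memory when the program halts. -/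

import Mathlib

/-! ## The Real RAM -/

namespace RealRAM

/-- A configuration: program counter, the cells designated to hold integers and the cells
designated to hold reals. Both kinds of cells are numbered by the natural numbers. -/
structure Config where
  pc : ℕ
  ints : ℕ → ℤ
  reals : ℕ → ℝ

/-- The address of a cell: given directly, or indirectly as the content of integer cell `k`. -/
inductive Addr where
  | dir (k : ℕ)
  | ind (k : ℕ)

/-- The address meant by `a`; indirect addressing through a negative integer is undefined. -/
def Addr.eval (c : Config) : Addr → Option ℕ
  | .dir k => some k
  | .ind k => if 0 ≤ c.ints k then some (c.ints k).toNat else none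

/-- A cell of either kind, used as an argument. -/
inductive Operand where
  | int (a : Addr)
  | real (a : Addr)

/-- The content of a cell, as a real number. -/
def Operand.eval (c : Config) : Operand → Option ℝ
  | .int a => (a.eval c).map fun k => (c.ints k : ℝ)
  | .real a => (a.eval c).map c.reals

/-- Integer arithmetic (there is no integer division). -/
inductive IntOp where
  | add
  | sub
  | mul

def IntOp.eval : IntOp → ℤ → ℤ → ℤ
  | .add, x, y => x + y
  | .sub, x, y => x - y
  | .mul, x, y => x * y

/-- Arithmetic with a real result. -/
inductive RealOp where
  | add
  | sub
  | mul
  | div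

/-- Division by zero is undefined. -/
noncomputable def RealOp.eval : RealOp → ℝ → ℝ → Option ℝ
  | .add, x, y => some (x + y)
  | .sub, x, y => some (x - y)
  | .mul, x, y => some (x * y)
  | .div, x, y => if y = 0 then none else some (x / y)

/-- Comparisons. -/
inductive Rel where
  | eq
  | lt

open Classical in
/-- The Boolean result of a comparison, stored as the integer `1` (true) or `0` (false). -/
noncomputable def Rel.eval : Rel → ℝ → ℝ → ℤ
  | .eq, x, y => if x = y then 1 else 0
  | .lt, x, y => if x < y then 1 else 0

/-- The instructions. Real numbers are never written to integer cells: the only integer that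
depends on real cells is the Boolean result of a comparison. -/
inductive Instr where
  /-- write the integer constant `z` to integer cell `d` -/
  | const (d : Addr) (z : ℤ)
  /-- integer arithmetic on integer cells, the result goes to an integer cell -/
  | intOp (op : IntOp) (d a b : Addr)
  /-- arithmetic on cells of either kind, the result goes to a real cell -/
  | realOp (op : RealOp) (d : Addr) (a b : Operand)
  /-- comparison of cells of either kind, the Boolean result goes to an integer cell -/
  | compare (r : Rel) (d : Addr) (a b : Operand)
  /-- jump to instruction number `target` if integer cell `a` is true (nonzero) -/
  | jump (a : Addr) (target : ℕ)
  /-- terminate -/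
  | halt

/-- A program is a finite sequence of instructions, numbered from `0`. -/
abbrev Program := List Instr

/-- Write `z` to integer cell `k` and proceed to the next instruction. -/
def Config.writeInt (c : Config) (k : ℕ) (z : ℤ) : Config :=
  { pc := c.pc + 1, ints := Function.update c.ints k z, reals := c.reals }

/-- Write `x` to real cell `k` and proceed to the next instruction. -/
def Config.writeReal (c : Config) (k : ℕ) (x : ℝ) : Config :=
  { pc := c.pc + 1, ints := c.ints, reals := Function.update c.reals k x }

/-- The effect of one instruction; `none` if it terminates the program or is undefined. -/
noncomputable def Instr.exec (c : Config) : Instr → Option Config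
  | .const d z => do
      let k ← d.eval c
      return c.writeInt k z
  | .intOp op d a b => do
      let i ← a.eval c
      let j ← b.eval c
      let k ← d.eval c
      return c.writeInt k (op.eval (c.ints i) (c.ints j))
  | .realOp op d a b => do
      let x ← a.eval c
      let y ← b.eval c
      let z ← op.eval x y
      let k ← d.eval c
      return c.writeReal k z
  | .compare r d a b => do
      let x ← a.eval c
      let y ← b.eval c
      let k ← d.eval c
      return c.writeInt k (r.eval x y)
  | .jump a target => do
      let i ← a.eval c
      return { c with pc := if c.ints i = 0 then c.pc + 1 else target }
  | .halt => none

/-- One step of a program, which executes the instruction at the program counter. -/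
noncomputable def step (prog : Program) (c : Config) : Option Config := do
  let instr ← prog[c.pc]?
  instr.exec c

/-- `Reaches prog c t c'`: started in `c`, the program is in configuration `c'` after
exactly `t` steps. -/
inductive Reaches (prog : Program) : Config → ℕ → Config → Prop
  | refl (c : Config) : Reaches prog c 0 c
  | step {c c' c'' : Config} {t : ℕ} :
      step prog c = some c' → Reaches prog c' t c'' → Reaches prog c (t + 1) c''

/-- Started in `c`, the program executes exactly `t` instructions, the last of which is a regular
`halt`, and `c'` holds the memory at that time. Every instruction has unit cost. -/
def HaltsIn (prog : Program) (c : Config) (t : ℕ) (c' : Config) : Prop :=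
  ∃ s, t = s + 1 ∧ Reaches prog c s c' ∧ prog[c'.pc]? = some Instr.halt

end RealRAM

/-! ## Point sets in the plane and their triangulations -/

/-- The Euclidean plane; `q 0` and `q 1` are the `x`- and the `y`-coordinate of `q`. -/
abbrev Plane := EuclideanSpace ℝ (Fin 2)

/-- No three distinct points lie on a line. -/
def GeneralPosition (P : Set Plane) : Prop :=
  ∀ a ∈ P, ∀ b ∈ P, ∀ c ∈ P, a ≠ b → a ≠ c → b ≠ c → ¬ Collinear ℝ {a, b, c}

/-- A triangulation of a point set `P`: a geometric simplicial complex with vertex set exactly `P`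
that covers exactly the convex hull of `P`. -/
def IsTriangulation (K : Geometry.SimplicialComplex ℝ Plane) (P : Set Plane) : Prop :=
  K.vertices = P ∧ K.space = convexHull ℝ P

/-! ## Input and output -/

/-- The initial configuration on an array `A` of `n` points: the coordinates of the points
occupy the first `2 * n` real cells, in order, and the first integer cell holds `n`.
All other cells are zero. -/
noncomputable def inputConfig {n : ℕ} (A : Fin n → Plane) : RealRAM.Config where
  pc := 0
  ints := fun k => if k = 0 then (n : ℤ) else 0
  reals := fun k =>
    if h : k / 2 < n then (if k % 2 = 0 then A ⟨k / 2, h⟩ 0 else A ⟨k / 2, h⟩ 1) else 0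

open Classical in
/-- The vertices of a simplex that is given by array indices. -/
noncomputable def simplexAt {n r : ℕ} (A : Fin n → Plane) (I : Fin r → Fin n) : Finset Plane :=
  Finset.univ.image fun j => A (I j)

/-- The integer memory `Z` stores the complex `K`, whose vertices are points of the array `A`:
the cells `0, 1, 2, 3` hold the number `m` of edges, the address `a` of the edge list,
the number `t` of triangles and the address `b` of the triangle list. The edge list is a contiguous
block of `m` pairs, the triangle list one of `t` triples of array indices; the lists contain
each edge and each triangle of `K` exactly once. -/
def Stores {n : ℕ} (A : Fin n → Plane) (Z : ℕ → ℤ)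
    (K : Geometry.SimplicialComplex ℝ Plane) : Prop :=
  ∃ (m a t b : ℕ) (E : Fin m → Fin 2 → Fin n) (T : Fin t → Fin 3 → Fin n),
    Z 0 = m ∧ Z 1 = a ∧ Z 2 = t ∧ Z 3 = b ∧
    (∀ (i : Fin m) (j : Fin 2), Z (a + 2 * i + j) = (E i j : ℕ)) ∧
    (∀ (i : Fin t) (j : Fin 3), Z (b + 3 * i + j) = (T i j : ℕ)) ∧
    Set.BijOn (fun i => simplexAt A (E i)) Set.univ {s | s ∈ K.faces ∧ s.card = 2} ∧
    Set.BijOn (fun i => simplexAt A (T i)) Set.univ {s | s ∈ K.faces ∧ s.card = 3}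

/-! ## Orientation -/

/-! Join the points from left to right by an x-monotone path. The path is a one-dimensional complex
that passes through every point, so only the parts of the convex hull above and below it remain to
be filled. A Graham scan fills each part. The scan keeps a chain, initially the whole path. If
consecutive chain vertices a, b, c have a reflex corner at b, the triangle a b c lies on the outer
side of the complex and meets it exactly in the edges a b and b c. It can therefore be glued on, and
the chain edge a c replaces the two old edges (`exists_glue_triangle`, `Slab.exists_cut`). When no
reflex corner is left, the chain is concave, and local concavity gives global concavity
(`ori_nonpos_of_concave`), so all points lie on one side of each chain edge. After one scan for each
side the complex fills the hull (`Slab.isTriangulation`).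

The geometric invariant is `Slab`: the complex lies between two chains of its own edges and contains
everything between the path and either chain. It is expressed by one inequality per edge. The sign
`s` is 1 for the upper and -1 for the lower side, so one argument serves both scans.

The time is linear by amortisation: every loop iteration either pushes a point or pops one, and each
pop emits one triangle and one edge. `reaches_scan_loop` runs the machine invariant `ScanMemory`
alongside the geometric invariant `ScanState`; the individual blocks of the program are executed
symbolically beforehand. -/

/-- Twice the signed area of the triangle `a b z`. -/
def ori (a b z : Plane) : ℝ :=
  (b 0 - a 0) * (z 1 - a 1) - (b 1 - a 1) * (z 0 - a 0)

theorem convex_ori_nonpos (s : ℝ) (a b : Plane) : Convex ℝ {z | s * ori a b z ≤ 0} := by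
  intro x hx y hy t u ht hu htu
  simp only [Set.mem_ofPred_eq, ori, PiLp.add_apply, PiLp.smul_apply, smul_eq_mul] at *
  obtain rfl : u = 1 - t := by linarith
  nlinarith [mul_nonneg ht (neg_nonneg.2 hx), mul_nonneg hu (neg_nonneg.2 hy)]

theorem convex_coord_le (r : ℝ) : Convex ℝ {z : Plane | z 0 ≤ r} := by
  intro x hx y hy t u ht hu htu
  simp only [Set.mem_ofPred_eq, PiLp.add_apply, PiLp.smul_apply, smul_eq_mul] at *
  obtain rfl : u = 1 - t := by linarith
  nlinarith [mul_nonneg ht (sub_nonneg.2 hx), mul_nonneg hu (sub_nonneg.2 hy)]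

theorem convex_le_coord (r : ℝ) : Convex ℝ {z : Plane | r ≤ z 0} := by
  intro x hx y hy t u ht hu htu
  simp only [Set.mem_ofPred_eq, PiLp.add_apply, PiLp.smul_apply, smul_eq_mul] at *
  obtain rfl : u = 1 - t := by linarith
  nlinarith [mul_nonneg ht (sub_nonneg.2 hx), mul_nonneg hu (sub_nonneg.2 hy)]

theorem coord_le_of_mem_convexHull {S : Set Plane} {r : ℝ} (h : ∀ q ∈ S, q 0 ≤ r) {z : Plane}
    (hz : z ∈ convexHull ℝ S) : z 0 ≤ r :=
  convexHull_min (t := {z : Plane | z 0 ≤ r}) h (convex_coord_le r) hz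

theorem le_coord_of_mem_convexHull {S : Set Plane} {r : ℝ} (h : ∀ q ∈ S, r ≤ q 0) {z : Plane}
    (hz : z ∈ convexHull ℝ S) : r ≤ z 0 :=
  convexHull_min (t := {z : Plane | r ≤ z 0}) h (convex_le_coord r) hz

theorem ori_nonpos_of_mem_convexHull {S : Set Plane} {s : ℝ} {a b : Plane}
    (h : ∀ q ∈ S, s * ori a b q ≤ 0) {z : Plane} (hz : z ∈ convexHull ℝ S) :
    s * ori a b z ≤ 0 :=
  convexHull_min (t := {z : Plane | s * ori a b z ≤ 0}) h (convex_ori_nonpos s a b) hz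

@[simp] theorem ori_left (a b : Plane) : ori a b a = 0 := by simp [ori]

@[simp] theorem ori_right (a b : Plane) : ori a b b = 0 := by simp only [ori]; ring

theorem ori_rotate (a b c : Plane) : ori b c a = ori a b c := by simp only [ori]; ring

theorem ori_swap (a b c : Plane) : ori a c b = -ori a b c := by simp only [ori]; ring

/-- If `q` lies below `c d`, and `c`, `d` lie below the line `v w`, then so does `q`. -/
theorem ori_nonpos_trans {s : ℝ} {v w c d q : Plane} (hvw : v 0 < w 0) (hcd : c 0 < d 0)
    (hcq : c 0 ≤ q 0) (hqd : q 0 ≤ d 0) (hc : s * ori v w c ≤ 0) (hd : s * ori v w d ≤ 0)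
    (hq : s * ori c d q ≤ 0) : s * ori v w q ≤ 0 := by
  have key : (d 0 - c 0) * (s * ori v w q) = (w 0 - v 0) * (s * ori c d q)
      + (d 0 - q 0) * (s * ori v w c) + (q 0 - c 0) * (s * ori v w d) := by
    simp only [ori]; ring
  have h1 := mul_nonneg (sub_nonneg.2 hvw.le) (neg_nonneg.2 hq)
  have h2 := mul_nonneg (sub_nonneg.2 hqd) (neg_nonneg.2 hc)
  have h3 := mul_nonneg (sub_nonneg.2 hcq) (neg_nonneg.2 hd)
  by_contra! h
  have := mul_pos (sub_pos.2 hcd) h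
  linarith

/-- The point of the line `a b` with first coordinate `x`. -/
theorem exists_mem_convexHull_pair {a b : Plane} (hab : a 0 < b 0) {x : ℝ} (hax : a 0 ≤ x)
    (hxb : x ≤ b 0) : ∃ q ∈ convexHull ℝ {a, b}, q 0 = x ∧ ori a b q = 0 := by
  have hd : (0 : ℝ) < b 0 - a 0 := sub_pos.2 hab
  refine ⟨(1 - (x - a 0) / (b 0 - a 0)) • a + ((x - a 0) / (b 0 - a 0)) • b, ?_, ?_, ?_⟩
  · rw [convexHull_pair]
    refine ⟨_, _, ?_, div_nonneg (by linarith) hd.le, by ring, rfl⟩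
    rw [sub_nonneg, div_le_one hd]; linarith
  · simp only [PiLp.add_apply, PiLp.smul_apply, smul_eq_mul]
    field_simp; ring
  · simp only [ori, PiLp.add_apply, PiLp.smul_apply, smul_eq_mul]
    field_simp; ring

theorem eq_of_coord_eq_of_ori_eq {a b q z : Plane} (hab : a 0 < b 0) (h0 : q 0 = z 0)
    (h : ori a b q = ori a b z) : q = z := by
  have h1 : q 1 = z 1 := by
    have : (b 0 - a 0) * (q 1 - z 1) = 0 := by
      simp only [ori, h0] at h; linarith
    rcases mul_eq_zero.1 this with h | h <;> linarith
  ext i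
  fin_cases i
  exacts [h0, h1]

theorem mem_convexHull_pair_of_ori {a b z : Plane} (hab : a 0 < b 0) (haz : a 0 ≤ z 0)
    (hzb : z 0 ≤ b 0) (h : ori a b z = 0) : z ∈ convexHull ℝ {a, b} := by
  obtain ⟨q, hq, h0, h1⟩ := exists_mem_convexHull_pair hab haz hzb
  rwa [← eq_of_coord_eq_of_ori_eq hab h0 (h1.trans h.symm)]

/-- The three signed quantities divided by `s * ori a b c` are the barycentric coordinates of `z`;
the factor `s` cancels, so both orientations are covered. -/
theorem mem_convexHull_triple {a b c z : Plane} {s : ℝ} (h : 0 < s * ori a b c)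
    (ha : 0 ≤ s * ori b c z) (hb : s * ori a c z ≤ 0) (hc : 0 ≤ s * ori a b z) :
    z ∈ convexHull ℝ {a, b, c} := by
  have hs : s ≠ 0 := by rintro rfl; simp at h
  have ho : ori a b c ≠ 0 := by intro h0; simp [h0] at h
  have hz : z = (s * ori b c z / (s * ori a b c)) • a + (-(s * ori a c z) / (s * ori a b c)) • b
      + (s * ori a b z / (s * ori a b c)) • c := by
    ext i
    simp only [PiLp.add_apply, PiLp.smul_apply, smul_eq_mul]
    field_simp
    fin_cases i <;> simp only [ori, Fin.zero_eta, Fin.mk_one, Fin.isValue] <;> ring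
  have h1 : s * ori b c z / (s * ori a b c) + -(s * ori a c z) / (s * ori a b c)
      + s * ori a b z / (s * ori a b c) = 1 := by
    field_simp
    simp only [ori]; ring
  rw [hz]
  have hcv := convex_convexHull ℝ ({a, b, c} : Set Plane)
  have hsub := subset_convexHull ℝ ({a, b, c} : Set Plane)
  have := hcv.sum_mem (t := Finset.univ)
    (w := ![s * ori b c z / (s * ori a b c), -(s * ori a c z) / (s * ori a b c),
      s * ori a b z / (s * ori a b c)]) (z := ![a, b, c]) ?_ ?_ ?_
  · simpa [Fin.sum_univ_three] using this
  · intro i _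
    fin_cases i
    · exact div_nonneg ha h.le
    · exact div_nonneg (by linarith) h.le
    · exact div_nonneg hc h.le
  · simpa [Fin.sum_univ_three] using h1
  · intro i _
    fin_cases i <;> exact hsub (by simp)

theorem not_collinear_of_ori {a b c : Plane} (h : ori a b c ≠ 0) : ¬ Collinear ℝ {a, b, c} := by
  intro hc
  obtain ⟨v, hv⟩ := (collinear_iff_of_mem (p₀ := a) (by simp)).1 hc
  obtain ⟨r, rfl⟩ := hv b (by simp)
  obtain ⟨t, rfl⟩ := hv c (by simp)
  apply h
  simp [ori]
  ring

open Classical in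
theorem affineIndependent_of_ori {a b c : Plane} (h : ori a b c ≠ 0) :
    AffineIndependent ℝ ((↑) : (({a, b, c} : Finset Plane)) → Plane) := by
  have h1 := (affineIndependent_iff_not_collinear_set.2 (not_collinear_of_ori h)).range
  refine h1.mono ?_
  intro x hx
  simp only [Finset.coe_insert, Finset.coe_singleton, Set.mem_insert_iff, Set.mem_singleton_iff] at hx
  rcases hx with rfl | rfl | rfl
  exacts [⟨0, rfl⟩, ⟨1, rfl⟩, ⟨2, rfl⟩]

/-! ## Gluing a triangle to a complex along two of its edges -/

/-- Of all faces of the triangle, only the triangle itself and `{a, c}` are not faces of the two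
edges along which it is glued. -/
theorem subset_triple_cases {α : Type*} [DecidableEq α] {a b c : α} {t : Finset α} (ht : t ⊆ {a, b, c}) :
    t = {a, b, c} ∨ t = {a, c} ∨ t ⊆ {a, b} ∨ t ⊆ {b, c} := by
  by_cases ha : a ∈ t
  · by_cases hc : c ∈ t
    · by_cases hb : b ∈ t
      · left; ext x; have := @ht x; grind
      · right; left; ext x; have := @ht x; grind
    · right; right; left; intro x hx; have := @ht x; grind
  · right; right; right; intro x hx; have := @ht x; grind

-- A point common to an old face `s` and a face `t` of the triangle lies in one of the two gluing
-- edges, say `e`. Since `e` belongs to `K`, the point is in the hull of `s ∩ e`; affine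
-- independence of the triangle's vertices then puts it in the hull of `s ∩ e ∩ t`.
open Classical in
theorem exists_glue_triangle {K : Geometry.SimplicialComplex ℝ Plane} {a b c : Plane}
    (h : ori a b c ≠ 0) (hab : {a, b} ∈ K.faces) (hbc : {b, c} ∈ K.faces)
    (hK : K.space ∩ convexHull ℝ {a, b, c} ⊆ convexHull ℝ {a, b} ∪ convexHull ℝ {b, c}) :
    ∃ K' : Geometry.SimplicialComplex ℝ Plane, K'.faces = K.faces ∪ {{a, b, c}, {a, c}} := by
  have hind := affineIndependent_of_ori h
  have hnew : ∀ t ∈ ({{a, b, c}, {a, c}} : Set (Finset Plane)), t ⊆ {a, b, c} := by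
    rintro t (rfl | rfl)
    · rfl
    · intro x; simp; tauto
  have hmix : ∀ s ∈ K.faces, ∀ t : Finset Plane, t ⊆ {a, b, c} →
      convexHull ℝ (s : Set Plane) ∩ convexHull ℝ (t : Set Plane) ⊆
        convexHull ℝ (s ∩ t : Set Plane) := by
    rintro s hs t ht z ⟨hzs, hzt⟩
    have hzT : z ∈ convexHull ℝ ({a, b, c} : Set Plane) := by
      refine convexHull_mono ?_ hzt
      intro x hx; simpa using ht hx
    have hz : ∃ e ∈ K.faces, e ⊆ {a, b, c} ∧ z ∈ convexHull ℝ (e : Set Plane) := by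
      rcases hK ⟨K.convexHull_subset_space hs hzs, hzT⟩ with hz | hz
      · exact ⟨_, hab, by intro x; simp; tauto, by simpa using hz⟩
      · exact ⟨_, hbc, by intro x; simp; tauto, by simpa using hz⟩
    obtain ⟨e, he, heT, hze⟩ := hz
    have hz1 := K.inter_subset_convexHull hs he ⟨hzs, hze⟩
    rw [← Finset.coe_inter] at hz1
    have := hind.convexHull_inter (Finset.inter_subset_right.trans heT : s ∩ e ⊆ _) ht
    have hz2 := this.symm.subset ⟨hz1, hzt⟩
    refine convexHull_mono ?_ hz2
    intro x; simp; tauto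
  refine ⟨{ faces := K.faces ∪ {{a, b, c}, {a, c}}
            isRelLowerSet_faces := ?_
            indep := ?_
            inter_subset_convexHull := ?_ }, rfl⟩
  · rintro s (hs | hs)
    · exact ⟨K.nonempty_of_mem_faces hs, fun t hts ht => Or.inl (K.down_closed hs hts ht)⟩
    · refine ⟨?_, fun t hts ht => ?_⟩
      · rcases hs with rfl | rfl <;> simp
      · rcases subset_triple_cases (Finset.Subset.trans hts (hnew s hs)) with h | h | h | h
        · exact Or.inr (Or.inl h)
        · exact Or.inr (Or.inr h)
        · exact Or.inl (K.down_closed hab h ht)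
        · exact Or.inl (K.down_closed hbc h ht)
  · rintro s (hs | hs)
    · exact K.indep hs
    · exact AffineIndependent.mono (t := ((({a, b, c} : Finset Plane)) : Set Plane)) hind
        (Finset.coe_subset.2 (hnew s hs))
  · rintro s t (hs | hs) (ht | ht)
    · exact K.inter_subset_convexHull hs ht
    · exact hmix s hs t (hnew t ht)
    · rw [Set.inter_comm, Set.inter_comm (s : Set Plane)]
      exact hmix t ht s (hnew s hs)
    · exact (hind.convexHull_inter (hnew s hs) (hnew t ht)).symm.subset

/-! ## Consecutive elements of a finite set of indices -/

/-- `v` and `w` are consecutive elements of `C`. -/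
def Consec (C : Finset ℕ) (v w : ℕ) : Prop :=
  v ∈ C ∧ w ∈ C ∧ v < w ∧ ∀ u ∈ C, u ≤ v ∨ w ≤ u

theorem consec_range {n i j : ℕ} : Consec (Finset.range n) i j ↔ j = i + 1 ∧ j < n := by
  simp only [Consec, Finset.mem_range]
  constructor
  · rintro ⟨h1, h2, h3, h4⟩
    have := h4 (i + 1)
    omega
  · rintro ⟨rfl, h⟩
    refine ⟨by omega, h, by omega, fun u _ => by omega⟩

/-- Removing `b` merges the two gaps beside it and leaves the others alone. The surviving gaps lie
entirely to the left of `a` or to the right of `c`, which later separates their edges from the glued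
triangle. -/
theorem Consec.erase {C : Finset ℕ} {a b c v w : ℕ} (hab : Consec C a b) (hbc : Consec C b c)
    (h : Consec (C.erase b) v w) :
    Consec C v w ∧ (w ≤ a ∨ c ≤ v) ∨ v = a ∧ w = c := by
  obtain ⟨hv, hw, hvw, hu⟩ := h
  obtain ⟨ha, hb, hab', hu1⟩ := hab
  obtain ⟨-, hc, hbc', hu2⟩ := hbc
  rw [Finset.mem_erase] at hv hw
  have e1 := hu a (Finset.mem_erase.2 ⟨by omega, ha⟩)
  have e2 := hu c (Finset.mem_erase.2 ⟨by omega, hc⟩)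
  have e3 := hu1 v hv.2
  have e4 := hu2 v hv.2
  have e5 := hu1 w hw.2
  have e6 := hu2 w hw.2
  have : (w ≤ a ∨ c ≤ v) ∨ v = a ∧ w = c := by omega
  rcases this with h | h
  · refine Or.inl ⟨⟨hv.2, hw.2, hvw, fun u huC => ?_⟩, h⟩
    by_cases hub : u = b
    · omega
    · exact hu u (Finset.mem_erase.2 ⟨hub, huC⟩)
  · exact Or.inr h

theorem exists_consec_right {C : Finset ℕ} {v m : ℕ} (hv : v ∈ C) (hm : m ∈ C) (h : v < m) :
    ∃ w, Consec C v w := by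
  have hne : (C.filter (v < ·)).Nonempty := ⟨m, by simp [hm, h]⟩
  have hmem := Finset.min'_mem _ hne
  refine ⟨(C.filter (v < ·)).min' hne, hv, (Finset.mem_filter.1 hmem).1,
    (Finset.mem_filter.1 hmem).2, fun u hu => ?_⟩
  by_cases huv : v < u
  · exact Or.inr (Finset.min'_le _ _ (by simp [hu, huv]))
  · omega

theorem exists_consec_left {C : Finset ℕ} {w m : ℕ} (hw : w ∈ C) (hm : m ∈ C) (h : m < w) :
    ∃ v, Consec C v w := by
  have hne : (C.filter (· < w)).Nonempty := ⟨m, by simp [hm, h]⟩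
  have hmem := Finset.max'_mem _ hne
  refine ⟨(C.filter (· < w)).max' hne, (Finset.mem_filter.1 hmem).1, hw,
    (Finset.mem_filter.1 hmem).2, fun u hu => ?_⟩
  by_cases huv : u < w
  · exact Or.inl (Finset.le_max' _ _ (by simp [hu, huv]))
  · omega

/-- A real number between the values of a function at the ends of `C` is between its values
at two consecutive elements. -/
theorem exists_consec_between {C : Finset ℕ} {f : ℕ → ℝ} {l m : ℕ} {x : ℝ} (hl : l ∈ C)
    (hm : m ∈ C) (hlm : l < m) (hC : ∀ u ∈ C, u ≤ m) (h1 : f l ≤ x) (h2 : x ≤ f m) :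
    ∃ v w, Consec C v w ∧ f v ≤ x ∧ x ≤ f w := by
  -- The left end is the largest element before `m` whose value is at most `x`. Its successor is `m`
  -- or has a value above `x`, so `f` need not be monotone.
  have hne : (C.filter (fun v => v < m ∧ f v ≤ x)).Nonempty := ⟨l, by simp [hl, hlm, h1]⟩
  have hmem := Finset.max'_mem _ hne
  set v := (C.filter (fun v => v < m ∧ f v ≤ x)).max' hne with hv
  simp only [Finset.mem_filter] at hmem
  obtain ⟨w, hw⟩ := exists_consec_right hmem.1 hm hmem.2.1
  refine ⟨v, w, hw, hmem.2.2, ?_⟩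
  by_cases hwm : w = m
  · rwa [hwm]
  · by_contra! hlt
    have hwle := Finset.le_max' (C.filter (fun v => v < m ∧ f v ≤ x)) w (by
      have := hC w hw.2.1
      simp only [Finset.mem_filter]
      exact ⟨hw.2.1, by omega, hlt.le⟩)
    have := hw.2.2.1
    omega

/-! ## Complexes bounded by two `x`-monotone chains -/

/-- The chain with index set `C` bounds the set `S` from above (if `s = 1`) or from below
(if `s = -1`), and `S` covers everything between the path `p 0, …, p (n - 1)` and the chain. -/
structure Side (p : ℕ → Plane) (n : ℕ) (s : ℝ) (S : Set Plane) (C : Finset ℕ) : Prop where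
  subset : C ⊆ Finset.range n
  bound : ∀ v w, Consec C v w → ∀ z ∈ S, p v 0 ≤ z 0 → z 0 ≤ p w 0 →
    s * ori (p v) (p w) z ≤ 0
  cover : ∀ i j v w, Consec (Finset.range n) i j → Consec C v w → ∀ z : Plane,
    p i 0 ≤ z 0 → z 0 ≤ p j 0 → p v 0 ≤ z 0 → z 0 ≤ p w 0 →
    0 ≤ s * ori (p i) (p j) z → s * ori (p v) (p w) z ≤ 0 → z ∈ S

open Classical in
/-- A complex with vertices `p 0, …, p (n - 1)` whose space lies between the chains `C` and `D`,
which consist of edges of the complex. -/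
structure Slab (p : ℕ → Plane) (n : ℕ) (s : ℝ) (K : Geometry.SimplicialComplex ℝ Plane)
    (C D : Finset ℕ) : Prop where
  vertices : K.vertices = p '' Set.Iio n
  side : Side p n s K.space C
  side_neg : Side p n (-s) K.space D
  edge : ∀ v w, Consec C v w → {p v, p w} ∈ K.faces
  edge_neg : ∀ v w, Consec D v w → {p v, p w} ∈ K.faces

theorem Slab.symm {p : ℕ → Plane} {n : ℕ} {s : ℝ} {K : Geometry.SimplicialComplex ℝ Plane}
    {C D : Finset ℕ} (h : Slab p n s K C D) : Slab p n (-s) K D C :=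
  ⟨h.vertices, h.side_neg, by simpa using h.side, h.edge_neg, h.edge⟩

/-- Every inequality is affine in `z`, so it suffices to check it at the three vertices. -/
theorem mem_convexHull_triple_imp {a b c z : Plane} {s : ℝ} (h : 0 < s * ori a b c)
    (hab : a 0 < b 0) (hbc : b 0 < c 0) (hz : z ∈ convexHull ℝ {a, b, c}) :
    a 0 ≤ z 0 ∧ z 0 ≤ c 0 ∧ 0 ≤ s * ori a b z ∧ 0 ≤ s * ori b c z ∧ s * ori a c z ≤ 0 := by
  have hr : s * ori b c a = s * ori a b c := by rw [ori_rotate]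
  have hw : s * ori a c b = -(s * ori a b c) := by rw [ori_swap]; ring
  refine ⟨le_coord_of_mem_convexHull ?_ hz, coord_le_of_mem_convexHull ?_ hz, ?_, ?_,
    ori_nonpos_of_mem_convexHull ?_ hz⟩
  · rintro q (rfl | rfl | rfl) <;> linarith
  · rintro q (rfl | rfl | rfl) <;> linarith
  · have := ori_nonpos_of_mem_convexHull (s := -s) (a := a) (b := b) ?_ hz
    · linarith
    · rintro q (rfl | rfl | rfl)
      · simp
      · simp
      · linarith
  · have := ori_nonpos_of_mem_convexHull (s := -s) (a := b) (b := c) ?_ hz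
    · linarith
    · rintro q (rfl | rfl | rfl)
      · linarith
      · simp
      · simp
  · rintro q (rfl | rfl | rfl)
    · simp
    · linarith
    · simp

/-- A point above the broken line `a b c` and below the segment `a c`. -/
theorem mem_convexHull_triple_of_coord {a b c z : Plane} {s : ℝ} (h : 0 < s * ori a b c)
    (hab : a 0 < b 0) (hbc : b 0 < c 0) (hac : s * ori a c z ≤ 0)
    (hz : z 0 ≤ b 0 ∧ 0 ≤ s * ori a b z ∨ b 0 ≤ z 0 ∧ 0 ≤ s * ori b c z) :
    z ∈ convexHull ℝ {a, b, c} := by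
  -- This identity transfers the inequality from the edge over which `z` lies to the other edge,
  -- which supplies the missing barycentric coordinate.
  have key : (b 0 - a 0) * (s * ori b c z) =
      (c 0 - b 0) * (s * ori a b z) + (b 0 - z 0) * (s * ori a b c) := by
    simp only [ori]; ring
  have h1 := sub_pos.2 hab
  have h2 := sub_pos.2 hbc
  rcases hz with ⟨hz, ho⟩ | ⟨hz, ho⟩
  · have h3 := mul_nonneg h2.le ho
    have h4 := mul_nonneg (sub_nonneg.2 hz) h.le
    refine mem_convexHull_triple h ?_ hac ho
    by_contra! hlt
    have := mul_pos_of_neg_of_neg hlt (neg_lt_zero.2 h1)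
    linarith
  · have h3 := mul_nonneg h1.le ho
    have h4 := mul_nonneg (sub_nonneg.2 hz) h.le
    refine mem_convexHull_triple h ho hac ?_
    by_contra! hlt
    have := mul_pos_of_neg_of_neg hlt (neg_lt_zero.2 h2)
    linarith

/-- On a vertical line both orientation functions change by positive multiples of `s * (z 1 - q 1)`.
So a point on the `s`-side of `q` inherits the bound that `q` satisfies with respect to another
line. -/
theorem ori_vertical {s : ℝ} {a b v w q z : Plane} (hab : a 0 < b 0) (hvw : v 0 < w 0)
    (h0 : q 0 = z 0) (hq : ori a b q = 0) (hz : 0 ≤ s * ori a b z) (hs : 0 ≤ s * ori v w q) :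
    0 ≤ s * ori v w z := by
  have e1 : (b 0 - a 0) * (s * (z 1 - q 1)) = s * ori a b z - s * ori a b q := by
    simp only [ori, h0]; ring
  have e2 : (w 0 - v 0) * (s * (z 1 - q 1)) = s * ori v w z - s * ori v w q := by
    simp only [ori, h0]; ring
  rw [hq, mul_zero, sub_zero] at e1
  have h1 : 0 ≤ s * (z 1 - q 1) := by
    rw [← e1] at hz
    exact nonneg_of_mul_nonneg_right hz (sub_pos.2 hab)
  have := mul_nonneg (sub_pos.2 hvw).le h1
  linarith

section
variable {p : ℕ → Plane} {n : ℕ}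

theorem coord_le_coord (hx : ∀ i j, i < j → j < n → p i 0 < p j 0) {i j : ℕ} (hij : i ≤ j)
    (hj : j < n) : p i 0 ≤ p j 0 := by
  rcases hij.eq_or_lt with rfl | h
  · rfl
  · exact (hx i j h hj).le

theorem Side.coord_lt {s : ℝ} {S : Set Plane} {C : Finset ℕ} (h : Side p n s S C)
    (hx : ∀ i j, i < j → j < n → p i 0 < p j 0) {v w : ℕ} (hvw : Consec C v w) :
    p v 0 < p w 0 :=
  hx v w hvw.2.2.1 (Finset.mem_range.1 (h.subset hvw.2.1))

open Classical in
/-- A reflex vertex `b` of the chain `C` is cut off by gluing a triangle to the complex. -/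
theorem Slab.exists_cut {s : ℝ} {K : Geometry.SimplicialComplex ℝ Plane} {C D : Finset ℕ}
    (hK : Slab p n s K C D) (hx : ∀ i j, i < j → j < n → p i 0 < p j 0) {a b c : ℕ}
    (hab : Consec C a b) (hbc : Consec C b c) (h : 0 < s * ori (p a) (p b) (p c)) :
    ∃ K' : Geometry.SimplicialComplex ℝ Plane, Slab p n s K' (C.erase b) D ∧
      K'.faces = K.faces ∪ {{p a, p b, p c}, {p a, p c}} ∧
      {p a, p b, p c} ∉ K.faces ∧ {p a, p c} ∉ K.faces := by
  have hxab := hK.side.coord_lt hx hab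
  have hxbc := hK.side.coord_lt hx hbc
  have hs : s ≠ 0 := by rintro rfl; simp at h
  have hcn : c < n := Finset.mem_range.1 (hK.side.subset hbc.2.1)
  have hT := fun z hz => mem_convexHull_triple_imp (z := z) h hxab hxbc hz
  have hsabc : s * ori (p a) (p c) (p b) ≤ 0 := by rw [ori_swap]; linarith
  -- Over each of the two edges, `bound` puts the complex on one side and the triangle lies on the
  -- other, so common points lie on the edge.
  have hinter : K.space ∩ convexHull ℝ {p a, p b, p c} ⊆
      convexHull ℝ {p a, p b} ∪ convexHull ℝ {p b, p c} := by
    rintro z ⟨hzK, hzT⟩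
    obtain ⟨h1, h2, h3, h4, h5⟩ := hT z hzT
    rcases le_total (z 0) (p b 0) with hzb | hzb
    · left
      have h6 := hK.side.bound a b hab z hzK h1 hzb
      exact mem_convexHull_pair_of_ori hxab h1 hzb
        ((mul_eq_zero.1 (le_antisymm h6 h3)).resolve_left hs)
    · right
      have h6 := hK.side.bound b c hbc z hzK hzb h2
      exact mem_convexHull_pair_of_ori hxbc hzb h2
        ((mul_eq_zero.1 (le_antisymm h6 h4)).resolve_left hs)
  have hori : ori (p a) (p b) (p c) ≠ 0 := by intro h0; simp [h0] at h
  -- The point of the segment from `p a` to `p c` at the abscissa of `p b` lies strictly on the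
  -- `s`-side of the chain, where the complex has no points.
  have hnac : ({p a, p c} : Finset Plane) ∉ K.faces := by
    intro hmem
    obtain ⟨q, hq, hq0, hq1⟩ := exists_mem_convexHull_pair (hxab.trans hxbc) hxab.le hxbc.le
    have hqK : q ∈ K.space := K.convexHull_subset_space hmem (by simpa using hq)
    have h6 := hK.side.bound a b hab q hqK (by rw [hq0]; exact hxab.le) hq0.le
    have e : (p b 0 - p a 0) * (s * ori (p a) (p b) (p c)) =
        (p c 0 - p a 0) * (s * ori (p a) (p b) q) := by
      have e1 : (p c 0 - p a 0) * (q 1 - p a 1) = (p c 1 - p a 1) * (p b 0 - p a 0) := by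
        simp only [ori, hq0] at hq1; linarith
      simp only [ori, hq0]
      linear_combination (-s * (p b 0 - p a 0)) * e1
    have h7 := mul_pos (sub_pos.2 hxab) h
    have h8 := mul_nonneg (sub_pos.2 (hxab.trans hxbc)).le (neg_nonneg.2 h6)
    linarith
  obtain ⟨K', hK'⟩ := exists_glue_triangle hori (hK.edge a b hab) (hK.edge b c hbc) hinter
  have hle : ∀ f ∈ K.faces, f ∈ K'.faces := fun f hf => by rw [hK']; exact Or.inl hf
  have hTK' : ({p a, p b, p c} : Finset Plane) ∈ K'.faces := by rw [hK']; simp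
  have hacK' : ({p a, p c} : Finset Plane) ∈ K'.faces := by rw [hK']; simp
  have hspace : ∀ z, z ∈ K'.space ↔ z ∈ K.space ∨ z ∈ convexHull ℝ {p a, p b, p c} := by
    intro z
    constructor
    · intro hz
      obtain ⟨f, hf, hzf⟩ := K'.mem_space_iff.1 hz
      rw [hK'] at hf
      rcases hf with hf | rfl | rfl
      · exact Or.inl (K.convexHull_subset_space hf hzf)
      · exact Or.inr (by simpa using hzf)
      · refine Or.inr (convexHull_mono ?_ hzf)
        intro x; simp; tauto
    · rintro (hz | hz)
      · obtain ⟨f, hf, hzf⟩ := K.mem_space_iff.1 hz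
        exact K'.convexHull_subset_space (hle f hf) hzf
      · exact K'.convexHull_subset_space hTK' (by simpa using hz)
  have hpab : p a ≠ p b := fun e => by rw [e] at hxab; exact lt_irrefl _ hxab
  have hpac : p a ≠ p c := fun e => by rw [e] at hxab; linarith
  refine ⟨K', ⟨?_, ⟨?_, ?_, ?_⟩, ⟨?_, ?_, ?_⟩, ?_, ?_⟩, hK', ?_, hnac⟩
  · rw [← hK.vertices]
    ext x
    simp only [Geometry.SimplicialComplex.mem_vertices, hK']
    constructor
    · rintro (hx | hx | hx)
      · exact hx
      · have h1 : p a ∈ ({x} : Finset Plane) := by rw [hx]; simp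
        have h2 : p b ∈ ({x} : Finset Plane) := by rw [hx]; simp
        simp only [Finset.mem_singleton] at h1 h2
        exact absurd (h1.trans h2.symm) hpab
      · have h1 : p a ∈ ({x} : Finset Plane) := by rw [hx]; simp
        have h2 : p c ∈ ({x} : Finset Plane) := by rw [hx]; simp
        simp only [Finset.mem_singleton] at h1 h2
        exact absurd (h1.trans h2.symm) hpac
    · exact fun hx => Or.inl hx
  · exact (Finset.erase_subset _ _).trans hK.side.subset
  · intro v w hvw z hz hvz hzw
    rcases hab.erase hbc hvw with ⟨hvw', hor⟩ | ⟨rfl, rfl⟩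
    · rcases (hspace z).1 hz with hz | hz
      · exact hK.side.bound v w hvw' z hz hvz hzw
      · obtain ⟨h1, h2, h3, h4, h5⟩ := hT z hz
        have hxvw := hK.side.coord_lt hx hvw'
        -- The triangle can share with an old chain edge only the abscissa of `p a` or of `p c`. On
        -- that vertical line the sign for the edge is the sign for the line through `p a` and `p
        -- c`.
        rcases hor with hwa | hcv
        · have hwa' := coord_le_coord hx hwa (hab.2.2.1.trans (hbc.2.2.1.trans hcn))
          have hw : w = a := by
            by_contra hne
            have := hx w a (by omega) (hab.2.2.1.trans (hbc.2.2.1.trans hcn))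
            linarith
          subst hw
          have hz0 : z 0 = p w 0 := le_antisymm hzw h1
          have e1 : s * ori (p w) (p c) z = (p c 0 - p w 0) * (s * (z 1 - p w 1)) := by
            simp only [ori, hz0]; ring
          have e2 : s * ori (p v) (p w) z = (p w 0 - p v 0) * (s * (z 1 - p w 1)) := by
            simp only [ori, hz0]; ring
          rw [e1] at h5
          rw [e2]
          exact mul_nonpos_of_nonneg_of_nonpos (sub_pos.2 hxvw).le
            (nonpos_of_mul_nonpos_right h5 (sub_pos.2 (hxab.trans hxbc)))
        · have hvn : v < n := Finset.mem_range.1 (hK.side.subset hvw'.1)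
          have hcv' := coord_le_coord hx hcv hvn
          have hv : v = c := by
            by_contra hne
            have := hx c v (by omega) hvn
            linarith
          subst hv
          have hz0 : z 0 = p v 0 := le_antisymm h2 hvz
          have e1 : s * ori (p a) (p v) z = (p v 0 - p a 0) * (s * (z 1 - p v 1)) := by
            simp only [ori, hz0]; ring
          have e2 : s * ori (p v) (p w) z = (p w 0 - p v 0) * (s * (z 1 - p v 1)) := by
            simp only [ori, hz0]; ring
          rw [e1] at h5
          rw [e2]
          exact mul_nonpos_of_nonneg_of_nonpos (sub_pos.2 hxvw).le
            (nonpos_of_mul_nonpos_right h5 (sub_pos.2 (hxab.trans hxbc)))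
    -- For the merged edge: old points are bounded by one of the two removed edges, whose ends are
    -- bounded by the line through `p a` and `p c`.
    · rcases (hspace z).1 hz with hz | hz
      · rcases le_total (z 0) (p b 0) with hzb | hzb
        · exact ori_nonpos_trans (hxab.trans hxbc) hxab hvz hzb (by simp) hsabc
            (hK.side.bound _ _ hab z hz hvz hzb)
        · exact ori_nonpos_trans (hxab.trans hxbc) hxbc hzb hzw hsabc (by simp)
            (hK.side.bound _ _ hbc z hz hzb hzw)
      · exact (hT z hz).2.2.2.2
  · intro i j v w hij hvw z hiz hzj hvz hzw h1 h2
    rw [hspace]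
    rcases hab.erase hbc hvw with ⟨hvw', -⟩ | ⟨rfl, rfl⟩
    · exact Or.inl (hK.side.cover i j v w hij hvw' z hiz hzj hvz hzw h1 h2)
    -- A point within the new edge is either within the removed edge above or below it, hence in the
    -- old complex, or beyond that edge, hence in the triangle.
    · rcases le_total (z 0) (p b 0) with hzb | hzb
      · rcases le_total (s * ori (p v) (p b) z) 0 with ho | ho
        · exact Or.inl (hK.side.cover i j v b hij hab z hiz hzj hvz hzb h1 ho)
        · exact Or.inr (mem_convexHull_triple_of_coord h hxab hxbc h2 (Or.inl ⟨hzb, ho⟩))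
      · rcases le_total (s * ori (p b) (p w) z) 0 with ho | ho
        · exact Or.inl (hK.side.cover i j b w hij hbc z hiz hzj hzb hzw h1 ho)
        · exact Or.inr (mem_convexHull_triple_of_coord h hxab hxbc h2 (Or.inr ⟨hzb, ho⟩))
  · exact hK.side_neg.subset
  · intro v w hvw z hz hvz hzw
    rcases (hspace z).1 hz with hz | hz
    · exact hK.side_neg.bound v w hvw z hz hvz hzw
    · obtain ⟨h1, h2, h3, h4, h5⟩ := hT z hz
      have hxvw := hK.side_neg.coord_lt hx hvw
      -- The point `q` of the old complex on the same vertical line respects the opposite chain, and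
      -- `z` lies even farther on the `s`-side.
      rcases le_total (z 0) (p b 0) with hzb | hzb
      · obtain ⟨q, hq, hq0, hq1⟩ := exists_mem_convexHull_pair hxab h1 hzb
        have hqK : q ∈ K.space :=
          K.convexHull_subset_space (hK.edge a b hab) (by simpa using hq)
        have := hK.side_neg.bound v w hvw q hqK (by rwa [hq0]) (by rwa [hq0])
        have := ori_vertical hxab hxvw hq0 hq1 h3 (by linarith)
        linarith
      · obtain ⟨q, hq, hq0, hq1⟩ := exists_mem_convexHull_pair hxbc hzb h2
        have hqK : q ∈ K.space :=
          K.convexHull_subset_space (hK.edge b c hbc) (by simpa using hq)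
        have := hK.side_neg.bound v w hvw q hqK (by rwa [hq0]) (by rwa [hq0])
        have := ori_vertical hxbc hxvw hq0 hq1 h4 (by linarith)
        linarith
  · intro i j v w hij hvw z hiz hzj hvz hzw h1 h2
    exact (hspace z).2 (Or.inl (hK.side_neg.cover i j v w hij hvw z hiz hzj hvz hzw h1 h2))
  · intro v w hvw
    rcases hab.erase hbc hvw with ⟨hvw', -⟩ | ⟨rfl, rfl⟩
    · exact hle _ (hK.edge v w hvw')
    · exact hacK'
  · intro v w hvw
    exact hle _ (hK.edge_neg v w hvw)
  · intro hmem
    exact hnac (K.down_closed hmem (by intro x; simp; tauto) (by simp))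

end

/-! ## The path through the points as a complex -/

theorem eq_of_mem_convexHull_pair {a b z : Plane} (hab : a 0 < b 0 ∨ a = b)
    (hz : z ∈ convexHull ℝ {a, b}) :
    a 0 ≤ z 0 ∧ z 0 ≤ b 0 ∧ (z 0 = a 0 → z = a) ∧ (z 0 = b 0 → z = b) ∧ ori a b z = 0 := by
  rcases hab with hab | rfl
  · have h1 := ori_nonpos_of_mem_convexHull (s := 1) (a := a) (b := b)
      (by rintro q (rfl | rfl) <;> simp) hz
    have h2 := ori_nonpos_of_mem_convexHull (s := -1) (a := a) (b := b)
      (by rintro q (rfl | rfl) <;> simp) hz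
    have h0 : ori a b z = 0 := by linarith
    refine ⟨le_coord_of_mem_convexHull ?_ hz, coord_le_of_mem_convexHull ?_ hz,
      fun h => ?_, fun h => ?_, h0⟩
    · rintro q (rfl | rfl) <;> linarith
    · rintro q (rfl | rfl) <;> linarith
    · exact eq_of_coord_eq_of_ori_eq hab h (by simp [h0])
    · exact eq_of_coord_eq_of_ori_eq hab h (by simp [h0])
  · simp only [Set.pair_eq_singleton, convexHull_singleton, Set.mem_singleton_iff] at hz
    subst hz
    simp

section
variable {p : ℕ → Plane} {n : ℕ}

/-- Capping the index makes the last segment the single point `p (n - 1)`. Then segments indexed by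
`i < n` contain all vertices, and a one-point path needs no special treatment. -/
theorem path_next (hx : ∀ i j, i < j → j < n → p i 0 < p j 0) {i : ℕ} (hi : i < n) :
    p i 0 < p (min (i + 1) (n - 1)) 0 ∨ p i = p (min (i + 1) (n - 1)) := by
  by_cases h : i + 1 < n
  · left
    rw [min_eq_left (by omega)]
    exact hx i (i + 1) (by omega) h
  · right
    congr 1
    omega

/-- Points on two different edges of the path that have the same first coordinate. -/
theorem path_inter (hx : ∀ i j, i < j → j < n → p i 0 < p j 0) {i j : ℕ} (hij : i < j)
    (hj : j < n) {z z' : Plane} (hz : z ∈ convexHull ℝ {p i, p (min (i + 1) (n - 1))})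
    (hz' : z' ∈ convexHull ℝ {p j, p (min (j + 1) (n - 1))}) (h : p j 0 ≤ z 0 ∨ z 0 = z' 0) :
    j = i + 1 ∧ z = p j ∧ (z 0 = z' 0 → z' = p j) := by
  have h1 := eq_of_mem_convexHull_pair (path_next hx (hij.trans hj)) hz
  have h2 := eq_of_mem_convexHull_pair (path_next hx hj) hz'
  have h3 : min (i + 1) (n - 1) = i + 1 := by omega
  rw [h3] at h1
  have h4 := coord_le_coord hx hij hj
  have h5 : p j 0 ≤ z 0 := by
    rcases h with h | h
    · exact h
    · rw [h]; exact h2.1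
  have hj' : j = i + 1 := by
    by_contra hne
    have := hx (i + 1) j (by omega) hj
    linarith [h1.2.1]
  subst hj'
  have h6 : z = p (i + 1) := h1.2.2.2.1 (le_antisymm h1.2.1 h5)
  exact ⟨rfl, h6, fun h => h2.2.2.1 (by rw [← h, h6])⟩

-- Since abscissas increase strictly, two different segments meet only if they are adjacent, and
-- then only in their common vertex.
open Classical in
theorem exists_path_complex (hx : ∀ i j, i < j → j < n → p i 0 < p j 0) :
    ∃ K : Geometry.SimplicialComplex ℝ Plane,
      ∀ f, f ∈ K.faces ↔ f.Nonempty ∧ ∃ i < n, f ⊆ {p i, p (min (i + 1) (n - 1))} := by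
  have hind : ∀ i < n, AffineIndependent ℝ
      ((↑) : (({p i, p (min (i + 1) (n - 1))} : Finset Plane)) → Plane) := by
    intro i hi
    rcases path_next hx hi with h | h
    · have hne : p i ≠ p (min (i + 1) (n - 1)) := fun e => by rw [← e] at h; exact lt_irrefl _ h
      refine (affineIndependent_of_ne ℝ hne).range.mono ?_
      intro x hx
      simp only [Finset.coe_insert, Finset.coe_singleton, Set.mem_insert_iff,
        Set.mem_singleton_iff] at hx
      rcases hx with rfl | rfl
      exacts [⟨0, rfl⟩, ⟨1, rfl⟩]
    · rw [← h, Finset.pair_eq_singleton]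
      have : Subsingleton (({p i} : Finset Plane)) := by
        constructor
        rintro ⟨x, hx⟩ ⟨y, hy⟩
        simp only [Finset.mem_singleton] at hx hy
        simp [hx, hy]
      exact affineIndependent_of_subsingleton ℝ _
  have hmem : ∀ (f : Finset Plane) (i : ℕ), f ⊆ {p i, p (min (i + 1) (n - 1))} →
      convexHull ℝ (f : Set Plane) ⊆ convexHull ℝ {p i, p (min (i + 1) (n - 1))} := by
    intro f i hf
    refine convexHull_mono ?_
    intro x hx
    simpa using hf hx
  have hlt : ∀ (s t : Finset Plane) (i j : ℕ), i < j → j < n →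
      s ⊆ {p i, p (min (i + 1) (n - 1))} → t ⊆ {p j, p (min (j + 1) (n - 1))} →
      convexHull ℝ (s : Set Plane) ∩ convexHull ℝ (t : Set Plane) ⊆
        convexHull ℝ (s ∩ t : Set Plane) := by
    rintro s t i j hij hj hs ht z ⟨hzs, hzt⟩
    obtain ⟨rfl, hz, -⟩ := path_inter hx hij hj (hmem s i hs hzs) (hmem t _ ht hzt) (Or.inr rfl)
    have hxi := hx i (i + 1) (by omega) hj
    subst hz
    apply subset_convexHull
    -- The shared vertex must belong to both faces: otherwise a face is contained in the other end
    -- of its segment. That end differs from the vertex for `s`; for `t` it may coincide with it,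
    -- and then the vertex is in `t` after all.
    constructor
    · by_contra hn
      have hsub : (s : Set Plane) ⊆ {p i} := by
        intro x hx
        have := hs hx
        rw [min_eq_left (by omega)] at this
        simp only [Finset.mem_insert, Finset.mem_singleton] at this
        rcases this with h | h
        · exact h
        · exact absurd (h ▸ hx) hn
      have := convexHull_mono hsub hzs
      simp only [convexHull_singleton, Set.mem_singleton_iff] at this
      rw [this] at hxi
      exact lt_irrefl _ hxi
    · by_contra hn
      have hsub : (t : Set Plane) ⊆ {p (min (i + 1 + 1) (n - 1))} := by
        intro x hx
        have := ht hx
        simp only [Finset.mem_insert, Finset.mem_singleton] at this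
        rcases this with h | h
        · exact absurd (h ▸ hx) hn
        · exact h
      have h1 := convexHull_mono hsub hzt
      simp only [convexHull_singleton, Set.mem_singleton_iff] at h1
      have h2 : t.Nonempty := by
        rw [← Finset.coe_nonempty, ← convexHull_nonempty_iff (𝕜 := ℝ)]
        exact ⟨_, hzt⟩
      obtain ⟨x, hxt⟩ := h2
      have h3 := hsub hxt
      simp only [Set.mem_singleton_iff] at h3
      rw [h3, ← h1] at hxt
      exact hn hxt
  refine ⟨{ faces := {f | f.Nonempty ∧ ∃ i < n, f ⊆ {p i, p (min (i + 1) (n - 1))}}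
            isRelLowerSet_faces := ?_
            indep := ?_
            inter_subset_convexHull := ?_ }, fun f => Iff.rfl⟩
  · rintro s ⟨hs, i, hi, hsi⟩
    exact ⟨hs, fun t hts ht => ⟨ht, i, hi, Finset.Subset.trans hts hsi⟩⟩
  · rintro s ⟨hs, i, hi, hsi⟩
    exact AffineIndependent.mono
      (t := ((({p i, p (min (i + 1) (n - 1))} : Finset Plane)) : Set Plane)) (hind i hi)
      (Finset.coe_subset.2 hsi)
  · rintro s t ⟨hs, i, hi, hsi⟩ ⟨ht, j, hj, htj⟩
    rcases lt_trichotomy i j with h | rfl | h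
    · exact hlt s t i j h hj hsi htj
    · exact ((hind i hi).convexHull_inter hsi htj).symm.subset
    · rw [Set.inter_comm, Set.inter_comm (s : Set Plane)]
      exact hlt t s j i h hi htj hsi

-- At the start both chains are the path and the region between them is degenerate: the bounds hold
-- with equality, and a point between the path and itself lies on it.
open Classical in
theorem path_slab (hx : ∀ i j, i < j → j < n → p i 0 < p j 0)
    {K : Geometry.SimplicialComplex ℝ Plane}
    (hK : ∀ f, f ∈ K.faces ↔ f.Nonempty ∧ ∃ i < n, f ⊆ {p i, p (min (i + 1) (n - 1))}) :
    Slab p n 1 K (Finset.range n) (Finset.range n) := by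
  have hspace : ∀ z ∈ K.space, ∃ i < n, z ∈ convexHull ℝ {p i, p (min (i + 1) (n - 1))} := by
    intro z hz
    obtain ⟨f, hf, hzf⟩ := K.mem_space_iff.1 hz
    obtain ⟨-, i, hi, hfi⟩ := (hK f).1 hf
    refine ⟨i, hi, convexHull_mono ?_ hzf⟩
    intro x hx
    simpa using hfi hx
  have hedge : ∀ v w, Consec (Finset.range n) v w → {p v, p w} ∈ K.faces := by
    intro v w hvw
    obtain ⟨rfl, hw⟩ := consec_range.1 hvw
    refine (hK _).2 ⟨by simp, v, by omega, ?_⟩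
    rw [min_eq_left (by omega)]
  have hbound : ∀ v w, Consec (Finset.range n) v w → ∀ z ∈ K.space, p v 0 ≤ z 0 →
      z 0 ≤ p w 0 → ori (p v) (p w) z = 0 := by
    intro v w hvw z hz h1 h2
    obtain ⟨rfl, hw⟩ := consec_range.1 hvw
    obtain ⟨i, hi, hzi⟩ := hspace z hz
    have hmin : min (v + 1) (n - 1) = v + 1 := by omega
    rcases lt_trichotomy i v with h | rfl | h
    · obtain ⟨rfl, rfl, -⟩ := path_inter hx h (by omega) hzi
        (z' := p v) (subset_convexHull ℝ _ (by simp)) (Or.inl h1)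
      simp
    · rw [hmin] at hzi
      exact (eq_of_mem_convexHull_pair (Or.inl (hx i (i + 1) (by omega) hw)) hzi).2.2.2.2
    · have h3 := eq_of_mem_convexHull_pair (path_next hx hi) hzi
      have h4 := coord_le_coord hx h hi
      have := path_inter hx h hi (z := p (v + 1)) (z' := z)
        (subset_convexHull ℝ _ (by simp [hmin])) hzi (Or.inr (by linarith [h3.1]))
      obtain ⟨rfl, h5, h6⟩ := this
      rw [h6 (by linarith [h3.1])]
      simp
  have hcover : ∀ s : ℝ, s ≠ 0 → ∀ i j v w, Consec (Finset.range n) i j →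
      Consec (Finset.range n) v w → ∀ z : Plane,
      p i 0 ≤ z 0 → z 0 ≤ p j 0 → p v 0 ≤ z 0 → z 0 ≤ p w 0 →
      0 ≤ s * ori (p i) (p j) z → s * ori (p v) (p w) z ≤ 0 → z ∈ K.space := by
    intro s hs i j v w hij hvw z hiz hzj hvz hzw h1 h2
    have hmemp : ∀ q ∈ convexHull ℝ {p i, p j}, q ∈ K.space := fun q hq =>
      K.convexHull_subset_space (hedge i j hij) (by simpa using hq)
    obtain ⟨rfl, hj⟩ := consec_range.1 hij
    obtain ⟨rfl, hw⟩ := consec_range.1 hvw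
    have hxi := hx i (i + 1) (by omega) hj
    have hxv := hx v (v + 1) (by omega) hw
    apply hmemp
    -- If the path edge and the chain edge differ, they share only the abscissa of a common vertex
    -- `q`, and the two inequalities force `z = q`.
    have hcase : ∀ q : Plane, z 0 = q 0 → 0 ≤ s * (z 1 - q 1) → s * (z 1 - q 1) ≤ 0 →
        q ∈ ({p i, p (i + 1)} : Set Plane) → z ∈ convexHull ℝ {p i, p (i + 1)} := by
      intro q h0 ha hb hq
      have : z 1 - q 1 = 0 := (mul_eq_zero.1 (le_antisymm hb ha)).resolve_left hs
      have hzq : z = q := by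
        ext k
        fin_cases k
        · exact h0
        · exact sub_eq_zero.1 this
      rw [hzq]
      exact subset_convexHull ℝ _ hq
    have eright : ∀ u v : Plane, z 0 = v 0 →
        s * ori u v z = (v 0 - u 0) * (s * (z 1 - v 1)) := by
      intro u v h; simp only [ori, h]; ring
    have eleft : ∀ u v : Plane, z 0 = u 0 →
        s * ori u v z = (v 0 - u 0) * (s * (z 1 - u 1)) := by
      intro u v h; simp only [ori, h]; ring
    rcases lt_trichotomy i v with h | rfl | h
    · have h4 := coord_le_coord hx (show i + 1 ≤ v by omega) (show v < n by omega)
      have hv : v = i + 1 := by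
        by_contra hne
        have := hx (i + 1) v (by omega) (by omega)
        linarith
      subst hv
      have h0 : z 0 = p (i + 1) 0 := le_antisymm hzj hvz
      rw [eright _ _ h0] at h1
      rw [eleft _ _ h0] at h2
      exact hcase _ h0 (nonneg_of_mul_nonneg_right h1 (sub_pos.2 hxi))
        (nonpos_of_mul_nonpos_right h2 (sub_pos.2 hxv)) (by simp)
    · exact mem_convexHull_pair_of_ori hxi hiz hzj
        ((mul_eq_zero.1 (le_antisymm h2 h1)).resolve_left hs)
    · have h4 := coord_le_coord hx (show v + 1 ≤ i by omega) (show i < n by omega)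
      have hv : i = v + 1 := by
        by_contra hne
        have := hx (v + 1) i (by omega) (by omega)
        linarith
      subst hv
      have h0 : z 0 = p (v + 1) 0 := le_antisymm hzw hiz
      rw [eleft _ _ h0] at h1
      rw [eright _ _ h0] at h2
      exact hcase _ h0 (nonneg_of_mul_nonneg_right h1 (sub_pos.2 hxi))
        (nonpos_of_mul_nonpos_right h2 (sub_pos.2 hxv)) (by simp)
  refine ⟨?_, ⟨Finset.Subset.refl _, ?_, hcover 1 one_ne_zero⟩,
    ⟨Finset.Subset.refl _, ?_, hcover (-1) (by norm_num)⟩, hedge, hedge⟩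
  · ext x
    rw [Geometry.SimplicialComplex.mem_vertices, hK]
    simp only [Finset.singleton_nonempty, true_and, Finset.singleton_subset_iff,
      Finset.mem_insert, Finset.mem_singleton, Set.mem_image, Set.mem_Iio]
    constructor
    · rintro ⟨i, hi, rfl | rfl⟩
      · exact ⟨i, hi, rfl⟩
      · exact ⟨_, by omega, rfl⟩
    · rintro ⟨i, hi, rfl⟩
      exact ⟨i, hi, Or.inl rfl⟩
  · intro v w hvw z hz h1 h2
    rw [hbound v w hvw z hz h1 h2]; simp
  · intro v w hvw z hz h1 h2
    rw [hbound v w hvw z hz h1 h2]; simp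

open Classical in
theorem path_faces_card_two (hx : ∀ i j, i < j → j < n → p i 0 < p j 0)
    {K : Geometry.SimplicialComplex ℝ Plane}
    (hK : ∀ f, f ∈ K.faces ↔ f.Nonempty ∧ ∃ i < n, f ⊆ {p i, p (min (i + 1) (n - 1))})
    (f : Finset Plane) :
    f ∈ K.faces ∧ f.card = 2 ↔ ∃ i, i + 1 < n ∧ {p i, p (i + 1)} = f := by
  rw [hK]
  constructor
  · rintro ⟨⟨-, i, hi, hf⟩, hc⟩
    by_cases h : i + 1 < n
    · rw [min_eq_left (by omega)] at hf
      exact ⟨i, h, (Finset.eq_of_subset_of_card_le hf (by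
        rw [hc]; exact Finset.card_le_two)).symm⟩
    · rw [show min (i + 1) (n - 1) = i by omega, Finset.pair_eq_singleton] at hf
      have := Finset.card_le_card hf
      simp [hc] at this
  · rintro ⟨i, hi, rfl⟩
    have hxi := hx i (i + 1) (by omega) hi
    refine ⟨⟨by simp, i, by omega, ?_⟩, Finset.card_pair ?_⟩
    · rw [min_eq_left (by omega)]
    · intro e
      rw [← e] at hxi
      exact lt_irrefl _ hxi

open Classical in
theorem path_faces_card_three {K : Geometry.SimplicialComplex ℝ Plane}
    (hK : ∀ f, f ∈ K.faces ↔ f.Nonempty ∧ ∃ i < n, f ⊆ {p i, p (min (i + 1) (n - 1))})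
    (f : Finset Plane) : ¬ (f ∈ K.faces ∧ f.card = 3) := by
  rw [hK]
  rintro ⟨⟨-, i, hi, hf⟩, hc⟩
  have := (Finset.card_le_card hf).trans Finset.card_le_two
  omega

/-! ## Locally concave chains -/

/-- The chain `C` has no reflex vertex among its elements below `k` other than the last. -/
def ConcaveBelow (p : ℕ → Plane) (s : ℝ) (C : Finset ℕ) (k : ℕ) : Prop :=
  ∀ u v w, w < k → Consec C u v → Consec C v w → s * ori (p u) (p v) (p w) ≤ 0

theorem Consec.right_unique {C : Finset ℕ} {v w w' : ℕ} (h : Consec C v w) (h' : Consec C v w') :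
    w = w' := by
  obtain ⟨-, h1, h2, h3⟩ := h
  obtain ⟨-, h1', h2', h3'⟩ := h'
  have := h3 w' h1'
  have := h3' w h1
  omega

theorem Consec.left_unique {C : Finset ℕ} {v v' w : ℕ} (h : Consec C v w) (h' : Consec C v' w) :
    v = v' := by
  obtain ⟨h1, -, h2, h3⟩ := h
  obtain ⟨h1', -, h2', h3'⟩ := h'
  have := h3 v' h1'
  have := h3' v h1
  omega

/-- The cross product compares the slopes of two chain edges. Each non-reflex vertex compares
adjacent slopes, and the identity `e` chains these comparisons without division. -/
theorem cross_nonpos {s : ℝ} {C : Finset ℕ} (hx : ∀ i j, i < j → j < n → p i 0 < p j 0)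
    (hC : C ⊆ Finset.range n) (hc : ConcaveBelow p s C n) {v w : ℕ} (hvw : Consec C v w) :
    ∀ c d, Consec C c d → v ≤ c →
      s * ((p w 0 - p v 0) * (p d 1 - p c 1) - (p w 1 - p v 1) * (p d 0 - p c 0)) ≤ 0 := by
  have hlt : ∀ {v w}, Consec C v w → p v 0 < p w 0 := fun {v w} h =>
    hx v w h.2.2.1 (Finset.mem_range.1 (hC h.2.1))
  intro c
  induction c using Nat.strong_induction_on with
  | _ c ih =>
    intro d hcd hvc
    rcases hvc.eq_or_lt with rfl | hvc
    · rw [hvw.right_unique hcd]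
      apply le_of_eq
      ring
    · obtain ⟨b, hb⟩ := exists_consec_left hcd.1 hvw.1 hvc
      have hvb : v ≤ b := by have := hb.2.2.2 v hvw.1; omega
      have h1 := ih b hb.2.2.1 c hb hvb
      have h2 := hc b c d (Finset.mem_range.1 (hC hcd.2.1)) hb hcd
      have hA := sub_pos.2 (hlt hvw)
      have hB := sub_pos.2 (hlt hb)
      have hD := sub_pos.2 (hlt hcd)
      have e : (p c 0 - p b 0) *
          (s * ((p w 0 - p v 0) * (p d 1 - p c 1) - (p w 1 - p v 1) * (p d 0 - p c 0))) =
          (p w 0 - p v 0) * (s * ori (p b) (p c) (p d)) + (p d 0 - p c 0) *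
          (s * ((p w 0 - p v 0) * (p c 1 - p b 1) - (p w 1 - p v 1) * (p c 0 - p b 0))) := by
        simp only [ori]; ring
      refine nonpos_of_mul_nonpos_right ?_ hB
      rw [e]
      exact add_nonpos (mul_nonpos_of_nonneg_of_nonpos hA.le h2)
        (mul_nonpos_of_nonneg_of_nonpos hD.le h1)

/-- Walking along the chain away from the edge, in either direction, changes the orientation by a
cross product of two chain edges, which has the right sign by `cross_nonpos`. -/
theorem ori_nonpos_of_concave {s : ℝ} {C : Finset ℕ}
    (hx : ∀ i j, i < j → j < n → p i 0 < p j 0)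
    (hC : C ⊆ Finset.range n) (hc : ConcaveBelow p s C n) {v w : ℕ} (hvw : Consec C v w) :
    ∀ c ∈ C, s * ori (p v) (p w) (p c) ≤ 0 := by
  have hright : ∀ c ∈ C, w ≤ c → s * ori (p v) (p w) (p c) ≤ 0 := by
    intro c
    induction c using Nat.strong_induction_on with
    | _ c ih =>
      intro hcC hwc
      rcases hwc.eq_or_lt with rfl | hwc
      · simp
      · obtain ⟨b, hb⟩ := exists_consec_left hcC hvw.2.1 hwc
        have hwb : w ≤ b := by have := hb.2.2.2 w hvw.2.1; omega
        have h1 := ih b hb.2.2.1 hb.1 hwb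
        have h2 := cross_nonpos hx hC hc hvw b c hb (hvw.2.2.1.le.trans hwb)
        have e : s * ori (p v) (p w) (p c) = s * ori (p v) (p w) (p b) +
          s * ((p w 0 - p v 0) * (p c 1 - p b 1) - (p w 1 - p v 1) * (p c 0 - p b 0)) := by
          simp only [ori]; ring
        rw [e]
        exact add_nonpos h1 h2
  have hleft : ∀ m, ∀ c ∈ C, c + m = v → s * ori (p v) (p w) (p c) ≤ 0 := by
    intro m
    induction m using Nat.strong_induction_on with
    | _ m ih =>
      intro c hcC hcm
      rcases Nat.eq_zero_or_pos m with rfl | hm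
      · rw [add_zero] at hcm
        simp [hcm]
      · obtain ⟨d, hd⟩ := exists_consec_right hcC hvw.1 (by omega)
        have hdv : d ≤ v := by have := hd.2.2.2 v hvw.1; omega
        have hcd := hd.2.2.1
        have h1 := ih (v - d) (by omega) d hd.2.1 (by omega)
        have h2 := cross_nonpos hx hC hc hd v w hvw (by omega)
        have e : s * ori (p v) (p w) (p c) = s * ori (p v) (p w) (p d) +
          s * ((p d 0 - p c 0) * (p w 1 - p v 1) - (p d 1 - p c 1) * (p w 0 - p v 0)) := by
          simp only [ori]; ring
        rw [e]
        exact add_nonpos h1 h2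
  intro c hcC
  rcases hvw.2.2.2 c hcC with h | h
  · exact hleft (v - c) c hcC (by omega)
  · exact hright c hcC h

/-- All points lie on one side of the edges of a locally concave chain. -/
theorem Side.ori_nonpos {s : ℝ} {S : Set Plane} {C : Finset ℕ} (h : Side p n s S C)
    (hx : ∀ i j, i < j → j < n → p i 0 < p j 0) (hc : ConcaveBelow p s C n)
    (hS : p '' Set.Iio n ⊆ S) (hn : 2 ≤ n) (h0 : 0 ∈ C) (h1 : n - 1 ∈ C) {v w : ℕ}
    (hvw : Consec C v w) {z : Plane} (hz : z ∈ convexHull ℝ (p '' Set.Iio n)) :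
    s * ori (p v) (p w) z ≤ 0 := by
  refine ori_nonpos_of_mem_convexHull ?_ hz
  rintro _ ⟨q, hq, rfl⟩
  rw [Set.mem_Iio] at hq
  -- A point is bounded by the chain edge over its abscissa, and the ends of that edge are bounded
  -- by the line through `p v` and `p w`.
  obtain ⟨c, d, hcd, hcq, hqd⟩ := exists_consec_between (f := fun i => p i 0) (x := p q 0)
    h0 h1 (by omega) (fun u hu => by have := Finset.mem_range.1 (h.subset hu); omega)
    (coord_le_coord hx (Nat.zero_le q) hq) (coord_le_coord hx (by omega) (by omega))
  exact ori_nonpos_trans (h.coord_lt hx hvw) (h.coord_lt hx hcd) hcq hqd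
    (ori_nonpos_of_concave hx h.subset hc hvw c hcd.1)
    (ori_nonpos_of_concave hx h.subset hc hvw d hcd.2.1)
    (h.bound c d hcd _ (hS ⟨q, hq, rfl⟩) hcq hqd)

/-- A point of the hull lies on one side of the path edge at its abscissa. The concave chain on that
side has the whole hull within its edges, so `cover` applies. Conversely, every face is spanned by
vertices. -/
theorem Slab.isTriangulation {s : ℝ} {K : Geometry.SimplicialComplex ℝ Plane}
    {C D : Finset ℕ} (h : Slab p n s K C D) (hx : ∀ i j, i < j → j < n → p i 0 < p j 0)
    (hC : ConcaveBelow p s C n) (hD : ConcaveBelow p (-s) D n)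
    (hends : 0 < n → 0 ∈ C ∧ n - 1 ∈ C ∧ 0 ∈ D ∧ n - 1 ∈ D) :
    IsTriangulation K (p '' Set.Iio n) := by
  have hS : p '' Set.Iio n ⊆ K.space := h.vertices ▸ K.vertices_subset_space
  refine ⟨h.vertices, Set.Subset.antisymm ?_ ?_⟩
  · intro z hz
    obtain ⟨f, hf, hzf⟩ := K.mem_space_iff.1 hz
    refine convexHull_mono ?_ hzf
    rw [← h.vertices, K.vertices_eq]
    exact Set.subset_biUnion_of_mem (u := fun k : Finset Plane => (k : Set Plane)) hf
  · intro z hz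
    -- With fewer than two points the chains have no edges, but the set is its own hull.
    rcases Nat.lt_or_ge n 2 with hn | hn
    · have hsub : (p '' Set.Iio n).Subsingleton := by
        rintro _ ⟨i, hi, rfl⟩ _ ⟨j, hj, rfl⟩
        rw [Set.mem_Iio] at hi hj
        rw [show i = j by omega]
      rw [hsub.convex.convexHull_eq] at hz
      exact hS hz
    · obtain ⟨h0, h1, h2, h3⟩ := hends (by omega)
      have hl : p 0 0 ≤ z 0 := by
        refine le_coord_of_mem_convexHull ?_ hz
        rintro _ ⟨i, hi, rfl⟩
        exact coord_le_coord hx (Nat.zero_le i) hi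
      have hr : z 0 ≤ p (n - 1) 0 := by
        refine coord_le_of_mem_convexHull ?_ hz
        rintro _ ⟨i, hi, rfl⟩
        rw [Set.mem_Iio] at hi
        exact coord_le_coord hx (by omega) (by omega)
      have hb : ∀ {B : Finset ℕ}, B ⊆ Finset.range n → 0 ∈ B → n - 1 ∈ B →
          ∃ v w, Consec B v w ∧ p v 0 ≤ z 0 ∧ z 0 ≤ p w 0 := by
        intro B hB hB0 hB1
        exact exists_consec_between (f := fun i => p i 0) hB0 hB1 (by omega)
          (fun u hu => by have := Finset.mem_range.1 (hB hu); omega) hl hr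
      obtain ⟨i, j, hij, hiz, hzj⟩ := hb (Finset.Subset.refl _)
        (Finset.mem_range.2 (by omega)) (Finset.mem_range.2 (by omega))
      rcases le_total 0 (s * ori (p i) (p j) z) with ho | ho
      · obtain ⟨v, w, hvw, hvz, hzw⟩ := hb h.side.subset h0 h1
        exact h.side.cover i j v w hij hvw z hiz hzj hvz hzw ho
          (h.side.ori_nonpos hx hC hS hn h0 h1 hvw hz)
      · obtain ⟨v, w, hvw, hvz, hzw⟩ := hb h.side_neg.subset h2 h3
        exact h.side_neg.cover i j v w hij hvw z hiz hzj hvz hzw (by linarith)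
          (h.side_neg.ori_nonpos hx hD hS hn h2 h3 hvw hz)

end

/-! ## Executing single instructions -/

namespace RealRAM

variable {prog : Program} {pc t : ℕ} {f : ℕ → ℤ} {g : ℕ → ℝ} {c c' c'' : Config}

theorem Reaches.trans {t' : ℕ} (h : Reaches prog c t c') (h' : Reaches prog c' t' c'') :
    Reaches prog c (t + t') c'' := by
  induction h with
  | refl => simpa using h'
  | step hs _ ih => rw [Nat.add_right_comm]; exact .step hs (ih h')

/-- This and the following rules take the rest of the execution as last argument, so that a block is
executed by composing them and its steps are counted along the way. -/
theorem Reaches.next {i : Instr} (h : prog[c.pc]? = some i) (hi : i.exec c = some c')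
    (hr : Reaches prog c' t c'') : Reaches prog c (t + 1) c'' :=
  .step (by simp [RealRAM.step, h, hi]) hr

theorem Addr.eval_ind {k m : ℕ} (h : f k = m) : Addr.eval ⟨pc, f, g⟩ (.ind k) = some m := by
  simp [Addr.eval, h]

theorem Operand.eval_real {a : Addr} {m : ℕ} (h : a.eval ⟨pc, f, g⟩ = some m) :
    Operand.eval ⟨pc, f, g⟩ (.real a) = some (g m) := by
  simp [Operand.eval, h]

theorem Operand.eval_int {a : Addr} {m : ℕ} {z : ℤ} (h : a.eval ⟨pc, f, g⟩ = some m)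
    (hz : f m = z) : Operand.eval ⟨pc, f, g⟩ (.int a) = some (z : ℝ) := by
  simp [Operand.eval, h, hz]

theorem Reaches.const {d : Addr} {z : ℤ} {k : ℕ} (h : prog[pc]? = some (.const d z))
    (hd : d.eval ⟨pc, f, g⟩ = some k)
    (hr : Reaches prog ⟨pc + 1, Function.update f k z, g⟩ t c'') :
    Reaches prog ⟨pc, f, g⟩ (t + 1) c'' :=
  .next h (by simp [Instr.exec, hd, Config.writeInt]) hr

theorem Reaches.intOp {op : IntOp} {d a b : Addr} {i j k : ℕ} {z : ℤ}
    (h : prog[pc]? = some (.intOp op d a b)) (hd : d.eval ⟨pc, f, g⟩ = some k)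
    (ha : a.eval ⟨pc, f, g⟩ = some i) (hb : b.eval ⟨pc, f, g⟩ = some j)
    (hz : op.eval (f i) (f j) = z)
    (hr : Reaches prog ⟨pc + 1, Function.update f k z, g⟩ t c'') :
    Reaches prog ⟨pc, f, g⟩ (t + 1) c'' :=
  .next h (by simp [Instr.exec, hd, ha, hb, hz, Config.writeInt]) hr

theorem Reaches.realOp {op : RealOp} {d : Addr} {a b : Operand} {x y z : ℝ} {k : ℕ}
    (h : prog[pc]? = some (.realOp op d a b)) (hd : d.eval ⟨pc, f, g⟩ = some k)
    (ha : a.eval ⟨pc, f, g⟩ = some x) (hb : b.eval ⟨pc, f, g⟩ = some y)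
    (hz : op.eval x y = some z)
    (hr : Reaches prog ⟨pc + 1, f, Function.update g k z⟩ t c'') :
    Reaches prog ⟨pc, f, g⟩ (t + 1) c'' :=
  .next h (by simp [Instr.exec, hd, ha, hb, hz, Config.writeReal]) hr

theorem Reaches.compare {r : Rel} {d : Addr} {a b : Operand} {x y : ℝ} {k : ℕ}
    (h : prog[pc]? = some (.compare r d a b)) (hd : d.eval ⟨pc, f, g⟩ = some k)
    (ha : a.eval ⟨pc, f, g⟩ = some x) (hb : b.eval ⟨pc, f, g⟩ = some y)
    (hr : Reaches prog ⟨pc + 1, Function.update f k (r.eval x y), g⟩ t c'') :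
    Reaches prog ⟨pc, f, g⟩ (t + 1) c'' :=
  .next h (by simp [Instr.exec, hd, ha, hb, Config.writeInt]) hr

theorem Reaches.jump_of_ne {k target : ℕ} (h : prog[pc]? = some (.jump (.dir k) target))
    (hk : f k ≠ 0) (hr : Reaches prog ⟨target, f, g⟩ t c'') :
    Reaches prog ⟨pc, f, g⟩ (t + 1) c'' :=
  .next h (by simp [Instr.exec, Addr.eval, hk]) hr

theorem Reaches.jump_of_eq {k target : ℕ} (h : prog[pc]? = some (.jump (.dir k) target))
    (hk : f k = 0) (hr : Reaches prog ⟨pc + 1, f, g⟩ t c'') :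
    Reaches prog ⟨pc, f, g⟩ (t + 1) c'' :=
  .next h (by simp [Instr.exec, Addr.eval, hk]) hr

theorem Rel.eval_ne_zero_of_lt {x y : ℝ} (h : x < y) : Rel.lt.eval x y ≠ 0 := by
  simp [Rel.eval, h]

theorem Rel.eval_eq_zero_of_not_lt {x y : ℝ} (h : ¬ x < y) : Rel.lt.eval x y = 0 := by
  simp [Rel.eval, h]

theorem Rel.eval_ne_zero_of_eq {x y : ℝ} (h : x = y) : Rel.eq.eval x y ≠ 0 := by
  simp [Rel.eval, h]

theorem Rel.eval_eq_zero_of_ne {x y : ℝ} (h : x ≠ y) : Rel.eq.eval x y = 0 := by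
  simp [Rel.eval, h]

end RealRAM

/-! ## Lists in the integer memory -/

/-- The memory `f` holds the reverse of a list from address `base` on. -/
def HoldsList (f : ℕ → ℤ) (base : ℕ) : List ℕ → Prop
  | [] => True
  | x :: l => f (base + l.length) = x ∧ HoldsList f base l

theorem HoldsList.congr {f f' : ℕ → ℤ} {base : ℕ} :
    ∀ {l : List ℕ}, HoldsList f base l →
      (∀ i, base ≤ i → i < base + l.length → f' i = f i) → HoldsList f' base l
  | [], _, _ => trivial
  | x :: l, h, hf => by
    refine ⟨?_, HoldsList.congr h.2 fun i h1 h2 => hf i h1 ?_⟩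
    · rw [hf _ (by omega) (by simp), h.1]
    · simp only [List.length_cons]; omega

/-- The indices in a list of edges, last one first. -/
def edgeCells (E : List (ℕ × ℕ)) : List ℕ := E.flatMap fun e => [e.2, e.1]

/-- The indices in a list of triangles, last one first. -/
def triangleCells (T : List (ℕ × ℕ × ℕ)) : List ℕ := T.flatMap fun e => [e.2.2, e.2.1, e.1]

@[simp] theorem edgeCells_cons (e : ℕ × ℕ) (E : List (ℕ × ℕ)) :
    edgeCells (e :: E) = e.2 :: e.1 :: edgeCells E := rfl

@[simp] theorem triangleCells_cons (e : ℕ × ℕ × ℕ) (T : List (ℕ × ℕ × ℕ)) :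
    triangleCells (e :: T) = e.2.2 :: e.2.1 :: e.1 :: triangleCells T := rfl

@[simp] theorem length_edgeCells : ∀ E : List (ℕ × ℕ), (edgeCells E).length = 2 * E.length
  | [] => rfl
  | e :: E => by simp only [edgeCells_cons, List.length_cons, length_edgeCells E]; ring

@[simp] theorem length_triangleCells :
    ∀ T : List (ℕ × ℕ × ℕ), (triangleCells T).length = 3 * T.length
  | [] => rfl
  | e :: T => by simp only [triangleCells_cons, List.length_cons, length_triangleCells T]; ring

theorem holdsList_edgeCells_cons {f : ℕ → ℤ} {base : ℕ} {e : ℕ × ℕ} {E : List (ℕ × ℕ)} :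
    HoldsList f base (edgeCells (e :: E)) ↔ f (base + 2 * E.length) = e.1 ∧
      f (base + 2 * E.length + 1) = e.2 ∧ HoldsList f base (edgeCells E) := by
  simp only [edgeCells_cons, HoldsList, length_edgeCells, List.length_cons, add_assoc]
  tauto

theorem holdsList_triangleCells_cons {f : ℕ → ℤ} {base : ℕ} {e : ℕ × ℕ × ℕ}
    {T : List (ℕ × ℕ × ℕ)} :
    HoldsList f base (triangleCells (e :: T)) ↔ f (base + 3 * T.length) = e.1 ∧
      f (base + 3 * T.length + 1) = e.2.1 ∧ f (base + 3 * T.length + 2) = e.2.2 ∧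
      HoldsList f base (triangleCells T) := by
  simp only [triangleCells_cons, HoldsList, length_triangleCells, List.length_cons, add_assoc,
    Nat.reduceAdd]
  tauto

theorem HoldsList.edge {f : ℕ → ℤ} {base : ℕ} :
    ∀ {E : List (ℕ × ℕ)}, HoldsList f base (edgeCells E) → ∀ i (hi : i < E.reverse.length),
      f (base + 2 * i) = (E.reverse[i]).1 ∧ f (base + 2 * i + 1) = (E.reverse[i]).2
  | [], _, i, hi => by simp at hi
  | e :: E, h, i, hi => by
    rw [holdsList_edgeCells_cons] at h
    simp only [List.length_reverse, List.length_cons] at hi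
    rcases Nat.lt_succ_iff_lt_or_eq.1 hi with hi' | rfl
    · have := HoldsList.edge h.2.2 i (by simpa using hi')
      simpa [List.getElem_append_left, hi'] using this
    · simp [h.1, h.2.1]

theorem HoldsList.triangle {f : ℕ → ℤ} {base : ℕ} :
    ∀ {T : List (ℕ × ℕ × ℕ)}, HoldsList f base (triangleCells T) →
      ∀ i (hi : i < T.reverse.length),
      f (base + 3 * i) = (T.reverse[i]).1 ∧ f (base + 3 * i + 1) = (T.reverse[i]).2.1 ∧
        f (base + 3 * i + 2) = (T.reverse[i]).2.2
  | [], _, i, hi => by simp at hi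
  | e :: T, h, i, hi => by
    rw [holdsList_triangleCells_cons] at h
    simp only [List.length_reverse, List.length_cons] at hi
    rcases Nat.lt_succ_iff_lt_or_eq.1 hi with hi' | rfl
    · have := HoldsList.triangle h.2.2.2 i (by simpa using hi')
      simpa [List.getElem_append_left, hi'] using this
    · simp [h.1, h.2.1, h.2.2.1]

/-! ## The program -/

open RealRAM Addr Operand in
/-- Two Graham scans along the path through the points. Integer cells: `0`–`3` output header,
`4` number of points, `5` zero, `6` one, `7` sign of the scan, `8` current point, `9` stack
pointer, `10` and `11` ends of the two lists, `12`–`22` scratch, `23`–`25` addresses of real scratch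
cells. The stack starts at cell `40`, the triangle list at `40 + n`, the edge list at `40 + 7 * n`.
Instructions: `15` path edges, `26` start of a scan, `28` main loop, `53` push, `57` cut off
a triangle, `71` end of a scan. -/
def scanProgram : RealRAM.Program := [
  -- Cell `5` stays 0, so adding it copies a cell.
  .intOp .add (dir 4) (dir 0) (dir 5),
  .const (dir 6) 1,
  .const (dir 7) 1,
  .const (dir 12) 40,
  .intOp .add (dir 3) (dir 12) (dir 4),
  -- There are at most `2 * n` triangles, so `6 * n` cells suffice for their list; the edge list
  -- comes last and has unlimited room.
  .const (dir 12) 6,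
  .intOp .mul (dir 12) (dir 12) (dir 4),
  .intOp .add (dir 1) (dir 3) (dir 12),
  .intOp .add (dir 10) (dir 1) (dir 5),
  .intOp .add (dir 11) (dir 3) (dir 5),
  -- The real scratch cells are the three cells after the input: `2 * n`, `2 * n + 1`, `2 * n + 2`.
  .intOp .add (dir 23) (dir 4) (dir 4),
  .intOp .add (dir 24) (dir 23) (dir 6),
  .intOp .add (dir 25) (dir 24) (dir 6),
  .const (dir 0) 0,
  .const (dir 8) 0,
  .intOp .add (dir 13) (dir 8) (dir 6),
  .compare .lt (dir 12) (int (dir 13)) (int (dir 4)),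
  .jump (dir 12) 19,
  -- Cell `6` holds 1, so this jump is unconditional.
  .jump (dir 6) 26,
  .intOp .add (ind 10) (dir 8) (dir 5),
  .intOp .add (dir 10) (dir 10) (dir 6),
  .intOp .add (ind 10) (dir 13) (dir 5),
  .intOp .add (dir 10) (dir 10) (dir 6),
  .intOp .add (dir 0) (dir 0) (dir 6),
  .intOp .add (dir 8) (dir 13) (dir 5),
  .jump (dir 6) 15,
  .const (dir 8) 0,
  .const (dir 9) 40,
  .compare .eq (dir 12) (int (dir 8)) (int (dir 4)),
  .jump (dir 12) 71,
  -- The stack starts at 40, so a pointer below 42 means fewer than two entries.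
  .const (dir 13) 42,
  .compare .lt (dir 12) (int (dir 9)) (int (dir 13)),
  .jump (dir 12) 53,
  .intOp .sub (dir 13) (dir 9) (dir 6),
  .intOp .sub (dir 14) (dir 13) (dir 6),
  .intOp .add (dir 15) (ind 13) (dir 5),
  .intOp .add (dir 16) (ind 14) (dir 5),
  .intOp .add (dir 17) (dir 15) (dir 15),
  .intOp .add (dir 18) (dir 17) (dir 6),
  .intOp .add (dir 19) (dir 16) (dir 16),
  .intOp .add (dir 20) (dir 19) (dir 6),
  .intOp .add (dir 21) (dir 8) (dir 8),
  .intOp .add (dir 22) (dir 21) (dir 6),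
  .realOp .sub (ind 23) (real (ind 17)) (real (ind 19)),
  .realOp .sub (ind 24) (real (ind 22)) (real (ind 20)),
  .realOp .mul (ind 23) (real (ind 23)) (real (ind 24)),
  .realOp .sub (ind 24) (real (ind 18)) (real (ind 20)),
  .realOp .sub (ind 25) (real (ind 21)) (real (ind 19)),
  .realOp .mul (ind 24) (real (ind 24)) (real (ind 25)),
  .realOp .sub (ind 23) (real (ind 23)) (real (ind 24)),
  .realOp .mul (ind 23) (int (dir 7)) (real (ind 23)),
  .compare .lt (dir 12) (int (dir 5)) (real (ind 23)),
  .jump (dir 12) 57,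
  .intOp .add (ind 9) (dir 8) (dir 5),
  .intOp .add (dir 9) (dir 9) (dir 6),
  .intOp .add (dir 8) (dir 8) (dir 6),
  .jump (dir 6) 28,
  .intOp .add (ind 10) (dir 16) (dir 5),
  .intOp .add (dir 10) (dir 10) (dir 6),
  .intOp .add (ind 10) (dir 8) (dir 5),
  .intOp .add (dir 10) (dir 10) (dir 6),
  .intOp .add (dir 0) (dir 0) (dir 6),
  .intOp .add (ind 11) (dir 16) (dir 5),
  .intOp .add (dir 11) (dir 11) (dir 6),
  .intOp .add (ind 11) (dir 15) (dir 5),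
  .intOp .add (dir 11) (dir 11) (dir 6),
  .intOp .add (ind 11) (dir 8) (dir 5),
  .intOp .add (dir 11) (dir 11) (dir 6),
  .intOp .add (dir 2) (dir 2) (dir 6),
  -- Only the stack is popped; the current point stays and is tested again.
  .intOp .add (dir 9) (dir 13) (dir 5),
  .jump (dir 6) 28,
  .compare .lt (dir 12) (int (dir 7)) (int (dir 5)),
  .jump (dir 12) 75,
  .const (dir 7) (-1),
  .jump (dir 6) 26,
  .halt]

/-- The memory during the execution of the program, apart from the state of the current scan. -/
structure Memory (n : ℕ) (p : ℕ → Plane) (E : List (ℕ × ℕ)) (T : List (ℕ × ℕ × ℕ))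
    (f : ℕ → ℤ) (g : ℕ → ℝ) : Prop where
  numEdges : f 0 = E.length
  edgeBase : f 1 = (40 + 7 * n : ℕ)
  numTriangles : f 2 = T.length
  triangleBase : f 3 = (40 + n : ℕ)
  numPoints : f 4 = n
  zero : f 5 = 0
  one : f 6 = 1
  edgeEnd : f 10 = (40 + 7 * n + 2 * E.length : ℕ)
  triangleEnd : f 11 = (40 + n + 3 * T.length : ℕ)
  scratch₀ : f 23 = (2 * n : ℕ)
  scratch₁ : f 24 = (2 * n + 1 : ℕ)
  scratch₂ : f 25 = (2 * n + 2 : ℕ)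
  edges : HoldsList f (40 + 7 * n) (edgeCells E)
  triangles : HoldsList f (40 + n) (triangleCells T)
  points : ∀ i < n, g (2 * i) = p i 0 ∧ g (2 * i + 1) = p i 1

/-- A frame rule: integer cells `7` to `9`, `12` to `22` and the stack below `40 + n` may change
freely, as may the real cells beyond the input. -/
theorem Memory.congr {n : ℕ} {p : ℕ → Plane} {E : List (ℕ × ℕ)} {T : List (ℕ × ℕ × ℕ)}
    {f f' : ℕ → ℤ} {g g' : ℕ → ℝ} (h : Memory n p E T f g)
    (hf : ∀ i, (i ≤ 6 ∨ i = 10 ∨ i = 11 ∨ 23 ≤ i ∧ i ≤ 25 ∨ 40 + n ≤ i) → f' i = f i)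
    (hg : ∀ i < 2 * n, g' i = g i) : Memory n p E T f' g' where
  numEdges := by rw [hf _ (by omega), h.numEdges]
  edgeBase := by rw [hf _ (by omega), h.edgeBase]
  numTriangles := by rw [hf _ (by omega), h.numTriangles]
  triangleBase := by rw [hf _ (by omega), h.triangleBase]
  numPoints := by rw [hf _ (by omega), h.numPoints]
  zero := by rw [hf _ (by omega), h.zero]
  one := by rw [hf _ (by omega), h.one]
  edgeEnd := by rw [hf _ (by omega), h.edgeEnd]
  triangleEnd := by rw [hf _ (by omega), h.triangleEnd]
  scratch₀ := by rw [hf _ (by omega), h.scratch₀]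
  scratch₁ := by rw [hf _ (by omega), h.scratch₁]
  scratch₂ := by rw [hf _ (by omega), h.scratch₂]
  edges := h.edges.congr fun i _ _ => hf i (by omega)
  triangles := h.triangles.congr fun i _ _ => hf i (by omega)
  points := fun i hi => by
    rw [hg _ (by omega), hg _ (by omega)]
    exact h.points i hi

/-- The memory during a scan: `l` is the stack and `k` the current point. -/
structure ScanMemory (n : ℕ) (p : ℕ → Plane) (E : List (ℕ × ℕ)) (T : List (ℕ × ℕ × ℕ)) (s : ℤ)
    (l : List ℕ) (k : ℕ) (f : ℕ → ℤ) (g : ℕ → ℝ) : Prop extends Memory n p E T f g where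
  sign : f 7 = s
  current : f 8 = k
  top : f 9 = (40 + l.length : ℕ)
  stack : HoldsList f 40 l

theorem ScanMemory.congr {n : ℕ} {p : ℕ → Plane} {E : List (ℕ × ℕ)} {T : List (ℕ × ℕ × ℕ)}
    {s : ℤ} {l : List ℕ} {k : ℕ} {f f' : ℕ → ℤ} {g g' : ℕ → ℝ}
    (h : ScanMemory n p E T s l k f g) (hf : ∀ i, (i ≤ 11 ∨ 23 ≤ i) → f' i = f i)
    (hg : ∀ i < 2 * n, g' i = g i) : ScanMemory n p E T s l k f' g' where
  toMemory := h.toMemory.congr (fun i hi => hf i (by omega)) hg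
  sign := by rw [hf _ (by omega), h.sign]
  current := by rw [hf _ (by omega), h.current]
  top := by rw [hf _ (by omega), h.top]
  stack := h.stack.congr fun i _ _ => hf i (by omega)

/-! ### Symbolic execution of the blocks of the program -/

open RealRAM

section
variable {n : ℕ} {p : ℕ → Plane} {E : List (ℕ × ℕ)} {T : List (ℕ × ℕ × ℕ)}
  {f : ℕ → ℤ} {g : ℕ → ℝ}

theorem reaches_init (hf : ∀ k, f k = if k = 0 then (n : ℤ) else 0)
    (hg : ∀ i < n, g (2 * i) = p i 0 ∧ g (2 * i + 1) = p i 1) :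
    ∃ f', Reaches scanProgram ⟨0, f, g⟩ 15 ⟨15, f', g⟩ ∧ Memory n p [] [] f' g ∧
      f' 7 = 1 ∧ f' 8 = 0 := by
  -- The final memory is left open and determined by unification along the execution.
  refine ⟨_, .intOp rfl rfl rfl rfl rfl <| .const rfl rfl <| .const rfl rfl <| .const rfl rfl <|
    .intOp rfl rfl rfl rfl rfl <| .const rfl rfl <| .intOp rfl rfl rfl rfl rfl <|
    .intOp rfl rfl rfl rfl rfl <| .intOp rfl rfl rfl rfl rfl <| .intOp rfl rfl rfl rfl rfl <|
    .intOp rfl rfl rfl rfl rfl <| .intOp rfl rfl rfl rfl rfl <| .intOp rfl rfl rfl rfl rfl <|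
    .const rfl rfl <| .const rfl rfl <| .refl _, ?_, ?_, ?_⟩
  · refine ⟨?_, ?_, ?_, ?_, ?_, ?_, ?_, ?_, ?_, ?_, ?_, ?_, trivial, trivial, hg⟩ <;>
      simp [IntOp.eval, hf] <;> ring
  · simp
  · simp

/-- The bound on `T` keeps the triangle list below the edge list, so that writing an edge does not
damage it. -/
theorem reaches_path_step (hM : Memory n p E T f g) {k : ℕ} (hk : f 8 = k) (hkn : k + 1 < n)
    (hT : T.length ≤ 2 * n) :
    ∃ f', Reaches scanProgram ⟨15, f, g⟩ 10 ⟨15, f', g⟩ ∧ Memory n p ((k, k + 1) :: E) T f' g ∧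
      f' 7 = f 7 ∧ f' 8 = (k + 1 : ℕ) := by
  refine ⟨_, .intOp (z := (k + 1 : ℕ)) rfl rfl rfl rfl ?_ <|
    .compare rfl rfl (Operand.eval_int (z := (k + 1 : ℕ)) rfl ?_)
      (Operand.eval_int (z := n) rfl ?_) <| .jump_of_ne rfl ?lt <|
    .intOp (z := k) rfl (Addr.eval_ind (m := 40 + 7 * n + 2 * E.length) ?_) rfl rfl ?_ <|
    .intOp (z := (40 + 7 * n + 2 * E.length + 1 : ℕ)) rfl rfl rfl rfl ?_ <|
    .intOp (z := (k + 1 : ℕ)) rfl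
      (Addr.eval_ind (m := 40 + 7 * n + 2 * E.length + 1) ?_) rfl rfl ?_ <|
    .intOp (z := (40 + 7 * n + 2 * (E.length + 1) : ℕ)) rfl rfl rfl rfl ?_ <|
    .intOp (z := (E.length + 1 : ℕ)) rfl rfl rfl rfl ?_ <|
    .intOp (z := (k + 1 : ℕ)) rfl rfl rfl rfl ?_ <|
    .jump_of_ne rfl ?_ <| .refl _, ?mem, ?_, ?_⟩
  case lt => exact Rel.eval_ne_zero_of_lt (by exact_mod_cast hkn)
  case mem =>
    refine ⟨?_, ?_, ?_, ?_, ?_, ?_, ?_, ?_, ?_, ?_, ?_, ?_, ?edges, ?triangles,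
      hM.points⟩
    case edges =>
      refine holdsList_edgeCells_cons.2 ⟨?_, ?_, hM.edges.congr fun i h1 h2 => ?_⟩
      iterate 2 simp (disch := omega) only [Function.update_of_ne, Function.update_self]
      simp only [length_edgeCells] at h2
      simp (disch := omega) only [Function.update_of_ne]
    case triangles =>
      refine hM.triangles.congr fun i h1 h2 => ?_
      simp only [length_triangleCells] at h2
      simp (disch := omega) only [Function.update_of_ne]
    all_goals
      simp (disch := omega) only [Function.update_of_ne, Function.update_self, hM.edgeBase,
        hM.numTriangles, hM.triangleBase, hM.numPoints, hM.zero, hM.one, hM.triangleEnd,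
        hM.scratch₀, hM.scratch₁, hM.scratch₂, List.length_cons]
  all_goals
    simp (disch := omega) only [Function.update_of_ne, Function.update_self, IntOp.eval, hk,
      hM.numEdges, hM.numPoints, hM.zero, hM.one, hM.edgeEnd, ne_eq, one_ne_zero,
      not_false_eq_true, add_zero]
  all_goals push_cast; ring

theorem reaches_path_exit (hM : Memory n p E T f g) {k : ℕ} (hk : f 8 = k) (hkn : n ≤ k + 1) :
    ∃ f', Reaches scanProgram ⟨15, f, g⟩ 4 ⟨26, f', g⟩ ∧ Memory n p E T f' g ∧
      f' 7 = f 7 := by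
  refine ⟨_, .intOp rfl rfl rfl rfl rfl <| .compare rfl rfl rfl rfl <|
    .jump_of_eq rfl ?_ <| .jump_of_ne rfl ?_ <| .refl _, ?_, ?_⟩
  · simp only [Function.update_self]
    apply Rel.eval_eq_zero_of_not_lt
    simp [IntOp.eval, hk, hM.one, hM.numPoints]
    exact_mod_cast hkn
  · simp [hM.one]
  · refine hM.congr ?_ fun _ _ => rfl
    intro i hi
    simp (disch := omega) only [Function.update_of_ne]
  · simp

variable {s : ℤ} {l : List ℕ} {k : ℕ}

theorem reaches_scan (hM : Memory n p E T f g) (hs : f 7 = s) :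
    ∃ f', Reaches scanProgram ⟨26, f, g⟩ 2 ⟨28, f', g⟩ ∧ ScanMemory n p E T s [] 0 f' g := by
  refine ⟨_, .const rfl rfl <| .const rfl rfl <| .refl _, hM.congr ?_ fun _ _ => rfl, ?_, ?_, ?_,
    trivial⟩
  · intro i hi
    simp (disch := omega) only [Function.update_of_ne]
  · simpa using hs
  · simp
  · simp

theorem reaches_scan_end (hM : ScanMemory n p E T s l n f g) :
    ∃ f', Reaches scanProgram ⟨28, f, g⟩ 2 ⟨71, f', g⟩ ∧ ScanMemory n p E T s l n f' g := by
  refine ⟨_, .compare rfl rfl (Operand.eval_int rfl hM.current)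
    (Operand.eval_int rfl hM.numPoints) <| .jump_of_ne rfl ?_ <| .refl _,
    hM.congr ?_ fun _ _ => rfl⟩
  · exact Rel.eval_ne_zero_of_eq rfl
  · intro i hi
    simp (disch := omega) only [Function.update_of_ne]

theorem reaches_short (hM : ScanMemory n p E T s l k f g) (hk : k < n) (hl : l.length < 2) :
    ∃ f', Reaches scanProgram ⟨28, f, g⟩ 5 ⟨53, f', g⟩ ∧ ScanMemory n p E T s l k f' g := by
  refine ⟨_, .compare rfl rfl (Operand.eval_int rfl hM.current)
    (Operand.eval_int rfl hM.numPoints) <| .jump_of_eq rfl ?_ <| .const rfl rfl <|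
    .compare rfl rfl (Operand.eval_int rfl hM.top) (Operand.eval_int (z := 42) rfl rfl) <|
    .jump_of_ne rfl ?_ <| .refl _, hM.congr ?_ fun _ _ => rfl⟩
  · exact Rel.eval_eq_zero_of_ne (by exact_mod_cast hk.ne)
  · exact Rel.eval_ne_zero_of_lt (by norm_cast; omega)
  · intro i hi
    simp (disch := omega) only [Function.update_of_ne]

theorem reaches_long (hM : ScanMemory n p E T s l k f g) (hk : k < n) (hl : 2 ≤ l.length) :
    ∃ f', Reaches scanProgram ⟨28, f, g⟩ 5 ⟨33, f', g⟩ ∧ ScanMemory n p E T s l k f' g := by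
  refine ⟨_, .compare rfl rfl (Operand.eval_int rfl hM.current)
    (Operand.eval_int rfl hM.numPoints) <| .jump_of_eq rfl ?_ <| .const rfl rfl <|
    .compare rfl rfl (Operand.eval_int rfl hM.top) (Operand.eval_int (z := 42) rfl rfl) <|
    .jump_of_eq rfl ?_ <| .refl _, hM.congr ?_ fun _ _ => rfl⟩
  · exact Rel.eval_eq_zero_of_ne (by exact_mod_cast hk.ne)
  · exact Rel.eval_eq_zero_of_not_lt (by norm_cast; omega)
  · intro i hi
    simp (disch := omega) only [Function.update_of_ne]

theorem reaches_addresses {a b : ℕ} (hM : ScanMemory n p E T s (b :: a :: l) k f g) :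
    ∃ f', Reaches scanProgram ⟨33, f, g⟩ 10 ⟨43, f', g⟩ ∧
      ScanMemory n p E T s (b :: a :: l) k f' g ∧ f' 13 = (40 + l.length + 1 : ℕ) ∧
      f' 15 = b ∧ f' 16 = a ∧ f' 17 = (2 * b : ℕ) ∧ f' 18 = (2 * b + 1 : ℕ) ∧
      f' 19 = (2 * a : ℕ) ∧ f' 20 = (2 * a + 1 : ℕ) ∧ f' 21 = (2 * k : ℕ) ∧
      f' 22 = (2 * k + 1 : ℕ) := by
  have hb := hM.stack.1
  have ha := hM.stack.2.1
  have ht := hM.top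
  simp only [List.length_cons, ← add_assoc] at hb ha ht
  refine ⟨_, .intOp (z := (40 + l.length + 1 : ℕ)) rfl rfl rfl rfl ?_ <|
    .intOp (z := (40 + l.length : ℕ)) rfl rfl rfl rfl ?_ <|
    .intOp (z := b) rfl rfl (Addr.eval_ind (m := 40 + l.length + 1) ?_) rfl ?_ <|
    .intOp (z := a) rfl rfl (Addr.eval_ind (m := 40 + l.length) ?_) rfl ?_ <|
    .intOp (z := (2 * b : ℕ)) rfl rfl rfl rfl ?_ <|
    .intOp (z := (2 * b + 1 : ℕ)) rfl rfl rfl rfl ?_ <|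
    .intOp (z := (2 * a : ℕ)) rfl rfl rfl rfl ?_ <|
    .intOp (z := (2 * a + 1 : ℕ)) rfl rfl rfl rfl ?_ <|
    .intOp (z := (2 * k : ℕ)) rfl rfl rfl rfl ?_ <|
    .intOp (z := (2 * k + 1 : ℕ)) rfl rfl rfl rfl ?_ <| .refl _, hM.congr ?mem fun _ _ => rfl,
    ?_, ?_, ?_, ?_, ?_, ?_, ?_, ?_, ?_⟩
  case mem =>
    intro i hi
    simp (disch := omega) only [Function.update_of_ne]
  all_goals
    simp (disch := omega) only [Function.update_of_ne, Function.update_self, IntOp.eval, ha, hb, ht,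
      hM.current, hM.zero, hM.one, add_zero]
  all_goals push_cast; ring

theorem reaches_orientation {a b : ℕ} (hM : ScanMemory n p E T s l k f g) (ha : a < n)
    (hb : b < n) (hk : k < n) (h17 : f 17 = (2 * b : ℕ)) (h18 : f 18 = (2 * b + 1 : ℕ))
    (h19 : f 19 = (2 * a : ℕ)) (h20 : f 20 = (2 * a + 1 : ℕ)) (h21 : f 21 = (2 * k : ℕ))
    (h22 : f 22 = (2 * k + 1 : ℕ)) :
    ∃ g', Reaches scanProgram ⟨43, f, g⟩ 8 ⟨51, f, g'⟩ ∧ ScanMemory n p E T s l k f g' ∧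
      g' (2 * n) = s * ori (p a) (p b) (p k) := by
  have r0 := hM.scratch₀
  have r1 := hM.scratch₁
  have r2 := hM.scratch₂
  obtain ⟨ha0, ha1⟩ := hM.points a ha
  obtain ⟨hb0, hb1⟩ := hM.points b hb
  obtain ⟨hk0, hk1⟩ := hM.points k hk
  refine ⟨_,
    .realOp (z := p b 0 - p a 0) rfl (Addr.eval_ind r0) (Operand.eval_real (Addr.eval_ind h17))
      (Operand.eval_real (Addr.eval_ind h19)) ?_ <|
    .realOp (z := p k 1 - p a 1) rfl (Addr.eval_ind r1) (Operand.eval_real (Addr.eval_ind h22))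
      (Operand.eval_real (Addr.eval_ind h20)) ?_ <|
    .realOp (z := (p b 0 - p a 0) * (p k 1 - p a 1)) rfl (Addr.eval_ind r0)
      (Operand.eval_real (Addr.eval_ind r0)) (Operand.eval_real (Addr.eval_ind r1)) ?_ <|
    .realOp (z := p b 1 - p a 1) rfl (Addr.eval_ind r1) (Operand.eval_real (Addr.eval_ind h18))
      (Operand.eval_real (Addr.eval_ind h20)) ?_ <|
    .realOp (z := p k 0 - p a 0) rfl (Addr.eval_ind r2) (Operand.eval_real (Addr.eval_ind h21))
      (Operand.eval_real (Addr.eval_ind h19)) ?_ <|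
    .realOp (z := (p b 1 - p a 1) * (p k 0 - p a 0)) rfl (Addr.eval_ind r1)
      (Operand.eval_real (Addr.eval_ind r1)) (Operand.eval_real (Addr.eval_ind r2)) ?_ <|
    .realOp (z := ori (p a) (p b) (p k)) rfl (Addr.eval_ind r0)
      (Operand.eval_real (Addr.eval_ind r0)) (Operand.eval_real (Addr.eval_ind r1)) ?_ <|
    .realOp (z := s * ori (p a) (p b) (p k)) rfl (Addr.eval_ind r0)
      (Operand.eval_int rfl hM.sign) (Operand.eval_real (Addr.eval_ind r0)) ?_ <| .refl _,
    hM.congr (fun _ _ => rfl) ?mem, ?_⟩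
  case mem =>
    intro i hi
    simp (disch := omega) only [Function.update_of_ne]
  all_goals
    simp (disch := omega) only [Function.update_of_ne, Function.update_self, RealOp.eval, ha0, ha1,
      hb0, hb1, hk0, hk1, ori]

theorem reaches_branch {x : ℝ} (hM : ScanMemory n p E T s l k f g) (hx : g (2 * n) = x) :
    ∃ f', Reaches scanProgram ⟨51, f, g⟩ 2 ⟨if 0 < x then 57 else 53, f', g⟩ ∧
      ScanMemory n p E T s l k f' g ∧ f' 13 = f 13 ∧ f' 15 = f 15 ∧ f' 16 = f 16 := by
  refine ⟨Function.update f 12 (Rel.lt.eval ((0 : ℤ) : ℝ) x), ?_, hM.congr ?_ fun _ _ => rfl,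
    rfl, rfl, rfl⟩
  · have hreal : Operand.eval ⟨51, f, g⟩ (.real (.ind 23)) = some x := by
      rw [Operand.eval_real (Addr.eval_ind hM.scratch₀), hx]
    refine .compare rfl rfl (Operand.eval_int rfl hM.zero) hreal ?_
    split_ifs with h
    · exact .jump_of_ne rfl (Rel.eval_ne_zero_of_lt (by simpa using h)) (.refl _)
    · exact .jump_of_eq rfl (Rel.eval_eq_zero_of_not_lt (by simpa using h)) (.refl _)
  · intro i hi
    simp (disch := omega) only [Function.update_of_ne]

/-- The bound on `l` keeps the written cell below the triangle list. -/
theorem reaches_push (hM : ScanMemory n p E T s l k f g) (hl : l.length < n) :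
    ∃ f', Reaches scanProgram ⟨53, f, g⟩ 4 ⟨28, f', g⟩ ∧
      ScanMemory n p E T s (k :: l) (k + 1) f' g := by
  have ht := hM.top
  refine ⟨_, .intOp (z := k) rfl (Addr.eval_ind ht) rfl rfl ?_ <|
    .intOp (z := (40 + l.length + 1 : ℕ)) rfl rfl rfl rfl ?_ <|
    .intOp (z := (k + 1 : ℕ)) rfl rfl rfl rfl ?_ <|
    .jump_of_ne rfl ?_ <| .refl _, hM.toMemory.congr ?mem fun _ _ => rfl, ?_, ?_, ?_, ?_,
    hM.stack.congr ?stack⟩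
  case mem =>
    intro i hi
    simp (disch := omega) only [Function.update_of_ne]
  case stack =>
    intro i h1 h2
    simp (disch := omega) only [Function.update_of_ne]
  all_goals
    simp (disch := omega) only [Function.update_of_ne, Function.update_self, IntOp.eval, ht,
      hM.current, hM.zero, hM.one, hM.sign, add_zero, ne_eq, one_ne_zero, not_false_eq_true,
      List.length_cons, add_assoc]
  all_goals push_cast; ring

/-- The bounds on `l` and `T` keep stack, triangle list and edge list disjoint, also after one more
triangle. -/
theorem reaches_cut {a b : ℕ} (hM : ScanMemory n p E T s (b :: a :: l) k f g)
    (hl : l.length + 2 ≤ n) (hT : T.length < 2 * n) (h13 : f 13 = (40 + l.length + 1 : ℕ))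
    (h15 : f 15 = b) (h16 : f 16 = a) :
    ∃ f', Reaches scanProgram ⟨57, f, g⟩ 14 ⟨28, f', g⟩ ∧
      ScanMemory n p ((a, k) :: E) ((a, b, k) :: T) s (a :: l) k f' g := by
  refine ⟨_, .intOp (z := a) rfl (Addr.eval_ind (m := 40 + 7 * n + 2 * E.length) ?_) rfl rfl ?_ <|
    .intOp (z := (40 + 7 * n + 2 * E.length + 1 : ℕ)) rfl rfl rfl rfl ?_ <|
    .intOp (z := k) rfl (Addr.eval_ind (m := 40 + 7 * n + 2 * E.length + 1) ?_) rfl rfl ?_ <|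
    .intOp (z := (40 + 7 * n + 2 * (E.length + 1) : ℕ)) rfl rfl rfl rfl ?_ <|
    .intOp (z := (E.length + 1 : ℕ)) rfl rfl rfl rfl ?_ <|
    .intOp (z := a) rfl (Addr.eval_ind (m := 40 + n + 3 * T.length) ?_) rfl rfl ?_ <|
    .intOp (z := (40 + n + 3 * T.length + 1 : ℕ)) rfl rfl rfl rfl ?_ <|
    .intOp (z := b) rfl (Addr.eval_ind (m := 40 + n + 3 * T.length + 1) ?_) rfl rfl ?_ <|
    .intOp (z := (40 + n + 3 * T.length + 2 : ℕ)) rfl rfl rfl rfl ?_ <|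
    .intOp (z := k) rfl (Addr.eval_ind (m := 40 + n + 3 * T.length + 2) ?_) rfl rfl ?_ <|
    .intOp (z := (40 + n + 3 * (T.length + 1) : ℕ)) rfl rfl rfl rfl ?_ <|
    .intOp (z := (T.length + 1 : ℕ)) rfl rfl rfl rfl ?_ <|
    .intOp (z := (40 + l.length + 1 : ℕ)) rfl rfl rfl rfl ?_ <|
    .jump_of_ne rfl ?_ <| .refl _,
    ⟨?_, ?_, ?_, ?_, ?_, ?_, ?_, ?_, ?_, ?_, ?_, ?_, ?edges, ?triangles, hM.points⟩,
    ?_, ?_, ?_, hM.stack.2.congr ?stack⟩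
  case edges =>
    refine holdsList_edgeCells_cons.2 ⟨?_, ?_, hM.edges.congr fun i h1 h2 => ?_⟩
    iterate 2 simp (disch := omega) only [Function.update_of_ne, Function.update_self]
    simp only [length_edgeCells] at h2
    simp (disch := omega) only [Function.update_of_ne]
  case triangles =>
    refine holdsList_triangleCells_cons.2 ⟨?_, ?_, ?_, hM.triangles.congr fun i h1 h2 => ?_⟩
    iterate 3 simp (disch := omega) only [Function.update_of_ne, Function.update_self]
    simp only [length_triangleCells] at h2
    simp (disch := omega) only [Function.update_of_ne]
  case stack =>
    intro i h1 h2
    simp only [List.length_cons] at h2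
    simp (disch := omega) only [Function.update_of_ne]
  all_goals
    simp (disch := omega) only [Function.update_of_ne, Function.update_self, IntOp.eval, h13, h15,
      h16, hM.current, hM.zero, hM.one, hM.sign, hM.numEdges, hM.edgeEnd, hM.triangleEnd,
      hM.numTriangles, hM.edgeBase, hM.triangleBase, hM.numPoints, hM.scratch₀, hM.scratch₁,
      hM.scratch₂, add_zero, ne_eq, one_ne_zero, not_false_eq_true, List.length_cons, add_assoc]
  all_goals push_cast; ring

theorem reaches_flip (hM : ScanMemory n p E T 1 l k f g) :
    ∃ f', Reaches scanProgram ⟨71, f, g⟩ 4 ⟨26, f', g⟩ ∧ Memory n p E T f' g ∧ f' 7 = -1 := by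
  refine ⟨_, .compare rfl rfl (Operand.eval_int rfl hM.sign) (Operand.eval_int rfl hM.zero) <|
    .jump_of_eq rfl (Rel.eval_eq_zero_of_not_lt (by norm_num)) <| .const rfl rfl <|
    .jump_of_ne rfl ?_ <| .refl _, hM.toMemory.congr ?_ fun _ _ => rfl, rfl⟩
  · simp [hM.one]
  · intro i hi
    simp (disch := omega) only [Function.update_of_ne]

theorem haltsIn_end (hM : ScanMemory n p E T (-1) l k f g) :
    ∃ f', HaltsIn scanProgram ⟨71, f, g⟩ 3 ⟨75, f', g⟩ ∧ Memory n p E T f' g := by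
  refine ⟨_, ⟨2, rfl, .compare rfl rfl (Operand.eval_int rfl hM.sign)
    (Operand.eval_int rfl hM.zero) <| .jump_of_ne rfl (Rel.eval_ne_zero_of_lt (by norm_num)) <|
    .refl _, rfl⟩, hM.toMemory.congr ?_ fun _ _ => rfl⟩
  intro i hi
  simp (disch := omega) only [Function.update_of_ne]

end

/-! ## Lists of the edges and triangles of a complex -/

open Classical in
/-- `E` and `T` list the edges and the triangles of `K` without repetition. -/
structure ListsFaces (p : ℕ → Plane) (n : ℕ) (K : Geometry.SimplicialComplex ℝ Plane)
    (E : List (ℕ × ℕ)) (T : List (ℕ × ℕ × ℕ)) : Prop where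
  edges_lt : ∀ e ∈ E, e.1 < n ∧ e.2 < n
  triangles_lt : ∀ e ∈ T, e.1 < n ∧ e.2.1 < n ∧ e.2.2 < n
  edges_nodup : (E.map fun e => ({p e.1, p e.2} : Finset Plane)).Nodup
  triangles_nodup : (T.map fun e => ({p e.1, p e.2.1, p e.2.2} : Finset Plane)).Nodup
  mem_edges : ∀ f, f ∈ E.map (fun e => ({p e.1, p e.2} : Finset Plane)) ↔
    f ∈ K.faces ∧ f.card = 2
  mem_triangles : ∀ f, f ∈ T.map (fun e => ({p e.1, p e.2.1, p e.2.2} : Finset Plane)) ↔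
    f ∈ K.faces ∧ f.card = 3

section
variable {p : ℕ → Plane} {n : ℕ}

theorem point_ne (hx : ∀ i j, i < j → j < n → p i 0 < p j 0) {i j : ℕ} (hi : i < n) (hj : j < n)
    (hij : i ≠ j) : p i ≠ p j := by
  intro e
  rcases lt_or_gt_of_ne hij with h | h
  · have := hx i j h hj
    rw [e] at this
    exact lt_irrefl _ this
  · have := hx j i h hi
    rw [e] at this
    exact lt_irrefl _ this

open Classical in
theorem ListsFaces.cons {K K' : Geometry.SimplicialComplex ℝ Plane} {E : List (ℕ × ℕ)}
    {T : List (ℕ × ℕ × ℕ)} (h : ListsFaces p n K E T)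
    (hx : ∀ i j, i < j → j < n → p i 0 < p j 0) {a b c : ℕ} (hab : a < b) (hbc : b < c)
    (hc : c < n) (hK' : K'.faces = K.faces ∪ {{p a, p b, p c}, {p a, p c}})
    (habc : {p a, p b, p c} ∉ K.faces) (hac : {p a, p c} ∉ K.faces) :
    ListsFaces p n K' ((a, c) :: E) ((a, b, c) :: T) := by
  have h1 : p a ≠ p b := point_ne hx (by omega) (by omega) (by omega)
  have h2 : p a ≠ p c := point_ne hx (by omega) (by omega) (by omega)
  have h3 : p b ≠ p c := point_ne hx (by omega) (by omega) (by omega)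
  have card3 : ({p a, p b, p c} : Finset Plane).card = 3 := Finset.card_eq_three.2
    ⟨_, _, _, h1, h2, h3, rfl⟩
  have card2 : ({p a, p c} : Finset Plane).card = 2 := Finset.card_pair h2
  refine ⟨?_, ?_, ?_, ?_, ?_, ?_⟩
  · intro e he
    rcases List.mem_cons.1 he with rfl | he
    · exact ⟨(hab.trans hbc).trans hc, hc⟩
    · exact h.edges_lt e he
  · intro e he
    rcases List.mem_cons.1 he with rfl | he
    · exact ⟨(hab.trans hbc).trans hc, hbc.trans hc, hc⟩
    · exact h.triangles_lt e he
  · rw [List.map_cons, List.nodup_cons]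
    exact ⟨fun hm => hac ((h.mem_edges _).1 hm).1, h.edges_nodup⟩
  · rw [List.map_cons, List.nodup_cons]
    exact ⟨fun hm => habc ((h.mem_triangles _).1 hm).1, h.triangles_nodup⟩
  · intro f
    rw [List.map_cons, List.mem_cons, h.mem_edges, hK']
    constructor
    · rintro (rfl | ⟨h4, h5⟩)
      · exact ⟨Or.inr (Or.inr rfl), card2⟩
      · exact ⟨Or.inl h4, h5⟩
    · rintro ⟨h4 | rfl | rfl, h5⟩
      · exact Or.inr ⟨h4, h5⟩
      · omega
      · exact Or.inl rfl
  · intro f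
    rw [List.map_cons, List.mem_cons, h.mem_triangles, hK']
    constructor
    · rintro (rfl | ⟨h4, h5⟩)
      · exact ⟨Or.inr (Or.inl rfl), card3⟩
      · exact ⟨Or.inl h4, h5⟩
    · rintro ⟨h4 | rfl | rfl, h5⟩
      · exact Or.inr ⟨h4, h5⟩
      · exact Or.inl rfl
      · omega

/-- The first `k` edges of the path through the points, last one first. -/
def pathEdges : ℕ → List (ℕ × ℕ)
  | 0 => []
  | k + 1 => (k, k + 1) :: pathEdges k

theorem mem_pathEdges {e : ℕ × ℕ} : ∀ {k : ℕ}, e ∈ pathEdges k ↔ e.1 < k ∧ e.2 = e.1 + 1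
  | 0 => by simp [pathEdges]
  | k + 1 => by
    rw [pathEdges, List.mem_cons, mem_pathEdges, Prod.ext_iff]
    omega

open Classical in
theorem pathEdges_nodup (hx : ∀ i j, i < j → j < n → p i 0 < p j 0) :
    ∀ {k : ℕ}, k ≤ n - 1 → ((pathEdges k).map fun e => ({p e.1, p e.2} : Finset Plane)).Nodup
  | 0, _ => by simp [pathEdges]
  | k + 1, hk => by
    rw [pathEdges, List.map_cons, List.nodup_cons]
    refine ⟨?_, pathEdges_nodup hx (by omega)⟩
    rw [List.mem_map]
    rintro ⟨⟨i, j⟩, hij, h⟩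
    obtain ⟨h1, h2⟩ := mem_pathEdges.1 hij
    simp only at h1 h2 h
    -- The newest edge contains `p (k + 1)`, which lies on no earlier edge.
    have : p (k + 1) ∈ ({p i, p j} : Finset Plane) := by rw [h]; simp
    simp only [Finset.mem_insert, Finset.mem_singleton] at this
    rcases this with h3 | h3
    · exact point_ne hx (by omega) (by omega) (by omega) h3
    · exact point_ne hx (by omega) (by omega) (by omega) h3

open Classical in
theorem listsFaces_path (hx : ∀ i j, i < j → j < n → p i 0 < p j 0)
    {K : Geometry.SimplicialComplex ℝ Plane}
    (hK : ∀ f, f ∈ K.faces ↔ f.Nonempty ∧ ∃ i < n, f ⊆ {p i, p (min (i + 1) (n - 1))}) :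
    ListsFaces p n K (pathEdges (n - 1)) [] := by
  refine ⟨?_, by simp, pathEdges_nodup hx le_rfl, by simp, ?_, ?_⟩
  · intro e he
    have := mem_pathEdges.1 he
    omega
  · intro f
    rw [path_faces_card_two hx hK, List.mem_map]
    constructor
    · rintro ⟨⟨i, j⟩, hij, rfl⟩
      obtain ⟨h1, h2⟩ := mem_pathEdges.1 hij
      simp only at h1 h2
      subst h2
      exact ⟨i, by omega, rfl⟩
    · rintro ⟨i, hi, rfl⟩
      exact ⟨(i, i + 1), mem_pathEdges.2 ⟨by simp only; omega, rfl⟩, rfl⟩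
  · intro f
    simpa using path_faces_card_three hK f

/-! ## The Graham scan -/

/-- The chain that consists of the stack `l` and the points from `k` on. -/
def stackChain (n : ℕ) (l : List ℕ) (k : ℕ) : Finset ℕ := l.toFinset ∪ Finset.Ico k n

theorem mem_stackChain {l : List ℕ} {k i : ℕ} :
    i ∈ stackChain n l k ↔ i ∈ l ∨ k ≤ i ∧ i < n := by
  simp [stackChain]

/-- A push only moves the current point from the unprocessed part of the chain to the stack, so the
complex needs no change. -/
theorem stackChain_push {l : List ℕ} {k : ℕ} (hk : k < n) :
    stackChain n (k :: l) (k + 1) = stackChain n l k := by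
  ext i
  simp only [mem_stackChain, List.mem_cons]
  by_cases hi : i ∈ l
  · simp [hi]
  · simp only [hi, or_false, false_or]
    omega

theorem stackChain_pop {b : ℕ} {l : List ℕ} {k : ℕ} (hl : (b :: l).Pairwise (· > ·))
    (hb : b < k) : stackChain n l k = (stackChain n (b :: l) k).erase b := by
  ext i
  simp only [mem_stackChain, Finset.mem_erase, List.mem_cons]
  have := (List.pairwise_cons.1 hl).1 i
  by_cases hi : i ∈ l
  · have := this hi
    simp only [hi, true_or, or_true, and_true, true_iff]
    omega
  · simp only [hi, false_or, or_false]
    omega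

theorem consec_stack_top {b : ℕ} {l : List ℕ} {k : ℕ} (hl : (b :: l).Pairwise (· > ·))
    (hb : b < k) (hk : k < n) : Consec (stackChain n (b :: l) k) b k := by
  refine ⟨by simp [mem_stackChain], by simp [mem_stackChain, hk], hb, fun u hu => ?_⟩
  rcases mem_stackChain.1 hu with hu | hu
  · rcases List.mem_cons.1 hu with rfl | hu
    · exact Or.inl le_rfl
    · exact Or.inl ((List.pairwise_cons.1 hl).1 u hu).le
  · exact Or.inr hu.1

theorem consec_stack_second {a b : ℕ} {l : List ℕ} {k : ℕ}
    (hl : (b :: a :: l).Pairwise (· > ·)) (hb : b < k) :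
    Consec (stackChain n (b :: a :: l) k) a b := by
  obtain ⟨h1, h2⟩ := List.pairwise_cons.1 hl
  refine ⟨by simp [mem_stackChain], by simp [mem_stackChain], h1 a (by simp), fun u hu => ?_⟩
  rcases mem_stackChain.1 hu with hu | hu
  · rcases List.mem_cons.1 hu with rfl | hu
    · exact Or.inr le_rfl
    · rcases List.mem_cons.1 hu with rfl | hu
      · exact Or.inl le_rfl
      · exact Or.inl ((List.pairwise_cons.1 h2).1 u hu).le
  · exact Or.inr (hb.le.trans hu.1)

/-- The invariant of a scan with sign `s`: `l` is the stack, `k` the current point, `K` the complex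
built so far, `E` and `T` its edges and triangles, of which there are at most `B` in the end. -/
structure ScanState (p : ℕ → Plane) (n : ℕ) (s : ℝ) (D : Finset ℕ) (B : ℕ) (l : List ℕ) (k : ℕ)
    (K : Geometry.SimplicialComplex ℝ Plane) (E : List (ℕ × ℕ)) (T : List (ℕ × ℕ × ℕ)) :
    Prop where
  le : k ≤ n
  sorted : l.Pairwise (· > ·)
  lt : ∀ i ∈ l, i < k
  slab : Slab p n s K (stackChain n l k) D
  concave : ConcaveBelow p s (stackChain n l k) k
  ends : 0 < n → 0 ∈ stackChain n l k ∧ n - 1 ∈ stackChain n l k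
  lists : ListsFaces p n K E T
  count : T.length + l.length + (n - k) ≤ B

variable {s : ℝ} {D : Finset ℕ} {B : ℕ} {l : List ℕ} {k : ℕ}
  {K : Geometry.SimplicialComplex ℝ Plane} {E : List (ℕ × ℕ)} {T : List (ℕ × ℕ × ℕ)}

theorem ScanState.length_le (h : ScanState p n s D B l k K E T) : l.length ≤ k := by
  have h1 : l.Nodup := h.sorted.imp fun h => ne_of_gt h
  rw [← List.toFinset_card_of_nodup h1, ← Finset.card_range k]
  apply Finset.card_le_card
  intro i hi
  exact Finset.mem_range.2 (h.lt i (List.mem_toFinset.1 hi))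

theorem ScanState.init (hslab : Slab p n s K (Finset.range n) D) (hl : ListsFaces p n K E T)
    (hB : T.length + n ≤ B) : ScanState p n s D B [] 0 K E T := by
  have hC : stackChain n [] 0 = Finset.range n := by
    ext i
    simp [mem_stackChain]
  refine ⟨Nat.zero_le _, List.Pairwise.nil, by simp, by rwa [hC], ?_, ?_, hl, by simpa using hB⟩
  · intro u v w hw
    exact absurd hw (Nat.not_lt_zero w)
  · intro hn
    rw [hC]
    simp only [Finset.mem_range]
    omega

theorem ScanState.push (h : ScanState p n s D B l k K E T) (hk : k < n)
    (ho : ∀ a b l', l = b :: a :: l' → s * ori (p a) (p b) (p k) ≤ 0) :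
    ScanState p n s D B (k :: l) (k + 1) K E T := by
  have hC := stackChain_push (l := l) hk
  refine ⟨hk, List.pairwise_cons.2 ⟨h.lt, h.sorted⟩, ?_, by rw [hC]; exact h.slab, ?_,
    by rw [hC]; exact h.ends, h.lists, ?_⟩
  · intro i hi
    rcases List.mem_cons.1 hi with rfl | hi
    · omega
    · have := h.lt i hi
      omega
  · rw [hC]
    intro u v w hw huv hvw
    rcases Nat.lt_succ_iff_lt_or_eq.1 hw with hw | rfl
    · exact h.concave u v w hw huv hvw
    -- The only new condition concerns the corner at the old stack top, which is exactly the one the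
    -- program tests; with fewer than two entries there is no such corner.
    · have hu := mem_stackChain.1 huv.1
      have hv := mem_stackChain.1 hvw.1
      have huv' := huv.2.2.1
      have hvw' := hvw.2.2.1
      have hs := h.sorted
      have hlt := h.lt
      match l, hu, hv with
      | [], hu, hv =>
        simp only [List.not_mem_nil, false_or] at hv
        omega
      | [b], hu, hv =>
        simp only [List.mem_singleton] at hu hv
        omega
      | b :: a :: l', hu, hv =>
        have hb := hlt b (by simp)
        have e1 := (consec_stack_top hs hb hk).left_unique hvw
        subst e1
        have e2 := (consec_stack_second (n := n) hs hb).left_unique huv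
        subst e2
        exact ho _ _ l' rfl
  -- One unprocessed point becomes one stack entry.
  · have := h.count
    simp only [List.length_cons]
    omega

open Classical in
theorem ScanState.cut {a b : ℕ} (h : ScanState p n s D B (b :: a :: l) k K E T)
    (hx : ∀ i j, i < j → j < n → p i 0 < p j 0) (hk : k < n)
    (ho : 0 < s * ori (p a) (p b) (p k)) :
    ∃ K', ScanState p n s D B (a :: l) k K' ((a, k) :: E) ((a, b, k) :: T) := by
  have hb := h.lt b (by simp)
  have hbk := consec_stack_top h.sorted hb hk
  have hab := consec_stack_second (n := n) h.sorted hb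
  have hC := stackChain_pop (n := n) h.sorted hb
  obtain ⟨K', hslab, hK', h1, h2⟩ := h.slab.exists_cut hx hab hbk ho
  refine ⟨K', h.le, (List.pairwise_cons.1 h.sorted).2,
    fun i hi => h.lt i (List.mem_cons_of_mem _ hi), by rwa [hC], ?_, ?_,
    h.lists.cons hx hab.2.2.1 hb hk hK' h1 h2, ?_⟩
  -- The new edge ends at `k`, so it takes part in no corner whose last vertex is below `k`.
  · rw [hC]
    intro u v w hw huv hvw
    have hvw' := hvw.2.2.1
    rcases hab.erase hbk huv with ⟨huv', -⟩ | ⟨-, rfl⟩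
    · rcases hab.erase hbk hvw with ⟨hvw'', -⟩ | ⟨-, rfl⟩
      · exact h.concave u v w hw huv' hvw''
      · exact absurd hw (lt_irrefl _)
    · omega
  -- The erased vertex lies strictly between `a` and `k`, so it is not an end of the path.
  · intro hn
    obtain ⟨h3, h4⟩ := h.ends hn
    have := hab.2.2.1
    rw [hC, Finset.mem_erase, Finset.mem_erase]
    exact ⟨⟨by omega, h3⟩, ⟨by omega, h4⟩⟩
  -- One stack entry becomes one triangle.
  · have := h.count
    simp only [List.length_cons] at this ⊢
    omega

end

/-! ## The execution of the program -/

section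

variable {p : ℕ → Plane} {n : ℕ} {E : List (ℕ × ℕ)} {T : List (ℕ × ℕ × ℕ)}
  {f : ℕ → ℤ} {g : ℕ → ℝ}

theorem reaches_path : ∀ (d k : ℕ) (f : ℕ → ℤ), k + d = n - 1 → Memory n p (pathEdges k) [] f g →
    f 8 = k → ∃ t ≤ 10 * d + 4, ∃ f', Reaches scanProgram ⟨15, f, g⟩ t ⟨26, f', g⟩ ∧
      Memory n p (pathEdges (n - 1)) [] f' g ∧ f' 7 = f 7
  | 0, k, f, hd, hM, hk => by
    obtain ⟨f', h1, h2, h3⟩ := reaches_path_exit hM hk (by omega)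
    have : n - 1 = k := by omega
    exact ⟨4, by omega, f', h1, by rwa [this], h3⟩
  | d + 1, k, f, hd, hM, hk => by
    obtain ⟨f₁, h1, h2, h3, h4⟩ := reaches_path_step hM hk (by omega) (by simp)
    obtain ⟨t, ht, f', h5, h6, h7⟩ := reaches_path d (k + 1) f₁ (by omega) h2 h4
    exact ⟨10 + t, by omega, f', h1.trans h5, h6, by rw [h7, h3]⟩

/-- The potential `l.length + 2 * (n - k)` drops by one in each iteration: a push adds an entry and
advances `k`, a cut removes an entry. The costliest iteration is a cut, with 5 + 10 + 8 + 2 + 14 =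
39 steps. -/
theorem reaches_scan_loop (hx : ∀ i j, i < j → j < n → p i 0 < p j 0) {s : ℤ} {D : Finset ℕ}
    {B : ℕ} (hB : B ≤ 2 * n) (m : ℕ) : ∀ (l : List ℕ) (k : ℕ)
    (K : Geometry.SimplicialComplex ℝ Plane) (E : List (ℕ × ℕ)) (T : List (ℕ × ℕ × ℕ))
    (f : ℕ → ℤ) (g : ℕ → ℝ), l.length + 2 * (n - k) = m → ScanState p n s D B l k K E T →
    ScanMemory n p E T s l k f g →
    ∃ t ≤ 39 * m + 2, ∃ l' K' E' T' f' g', Reaches scanProgram ⟨28, f, g⟩ t ⟨71, f', g'⟩ ∧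
      ScanState p n s D B l' n K' E' T' ∧ ScanMemory n p E' T' s l' n f' g' := by
  induction m using Nat.strong_induction_on with
  | _ m ih =>
    intro l k K E T f g hm hS hM
    have hlen := hS.length_le
    rcases hS.le.eq_or_lt with rfl | hk
    · obtain ⟨f', h1, h2⟩ := reaches_scan_end hM
      exact ⟨2, by omega, l, K, E, T, f', g, h1, hS, h2⟩
    -- A push follows a short stack after 5 steps or a failed orientation test after 25.
    · have hpush : ∀ (t₀ : ℕ) (f₁ : ℕ → ℤ) (g₁ : ℕ → ℝ), t₀ ≤ 25 →
          Reaches scanProgram ⟨28, f, g⟩ t₀ ⟨53, f₁, g₁⟩ → ScanMemory n p E T s l k f₁ g₁ →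
          (∀ a b l', l = b :: a :: l' → (s : ℝ) * ori (p a) (p b) (p k) ≤ 0) →
          ∃ t ≤ 39 * m + 2, ∃ l' K' E' T' f' g',
            Reaches scanProgram ⟨28, f, g⟩ t ⟨71, f', g'⟩ ∧
            ScanState p n s D B l' n K' E' T' ∧ ScanMemory n p E' T' s l' n f' g' := by
        intro t₀ f₁ g₁ ht₀ h1 h2 ho
        obtain ⟨f₂, h3, h4⟩ := reaches_push h2 (by omega)
        obtain ⟨t, ht, l', K', E', T', f', g', h5, h6⟩ :=
          ih (m - 1) (by omega) (k :: l) (k + 1) K E T f₂ g₁ (by simp only [List.length_cons]; omega)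
            (hS.push hk ho) h4
        exact ⟨t₀ + (4 + t), by omega, l', K', E', T', f', g', h1.trans (h3.trans h5), h6⟩
      match l with
      | [] =>
        obtain ⟨f₁, h1, h2⟩ := reaches_short hM hk (by simp)
        exact hpush 5 f₁ g (by omega) h1 h2 (by simp)
      | [b] =>
        obtain ⟨f₁, h1, h2⟩ := reaches_short hM hk (by simp)
        exact hpush 5 f₁ g (by omega) h1 h2 (by simp)
      | b :: a :: l =>
        have hb := hS.lt b (by simp)
        have ha := hS.lt a (by simp)
        have hcount := hS.count
        simp only [List.length_cons] at hm hcount hlen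
        obtain ⟨f₁, h1, h2⟩ := reaches_long hM hk (by simp)
        obtain ⟨f₂, h3, h4, a13, a15, a16, a17, a18, a19, a20, a21, a22⟩ := reaches_addresses h2
        obtain ⟨g₁, h5, h6, h7⟩ := reaches_orientation h4 (ha.trans hk) (hb.trans hk) hk
          a17 a18 a19 a20 a21 a22
        obtain ⟨f₃, h8, h9, b13, b15, b16⟩ := reaches_branch h6 h7
        have hr := h1.trans (h3.trans (h5.trans h8))
        by_cases ho : 0 < (s : ℝ) * ori (p a) (p b) (p k)
        · rw [if_pos ho] at hr
          obtain ⟨f₄, h10, h11⟩ := reaches_cut h9 (by omega) (by omega) (b13.trans a13)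
            (b15.trans a15) (b16.trans a16)
          obtain ⟨K₁, hS₁⟩ := hS.cut hx hk ho
          obtain ⟨t, ht, l', K', E', T', f', g', h12, h13⟩ :=
            ih (m - 1) (by omega) (a :: l) k K₁ _ _ f₄ g₁ (by simp only [List.length_cons]; omega)
              hS₁ h11
          exact ⟨_ + (14 + t), by omega, l', K', E', T', f', g', hr.trans (h10.trans h12), h13⟩
        · rw [if_neg ho] at hr
          refine hpush _ f₃ g₁ (by omega) hr h9 ?_
          rintro a' b' l' h
          simp only [List.cons.injEq] at h
          obtain ⟨rfl, rfl, -⟩ := h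
          exact not_lt.1 ho

/-- One Graham scan turns one of the two bounding chains of the complex into a concave chain. -/
theorem reaches_scan_phase (hx : ∀ i j, i < j → j < n → p i 0 < p j 0) {s : ℤ} {D : Finset ℕ}
    {B : ℕ} (hB : B ≤ 2 * n) {K : Geometry.SimplicialComplex ℝ Plane}
    (hslab : Slab p n s K (Finset.range n) D) (hlists : ListsFaces p n K E T)
    (hT : T.length + n ≤ B) (hM : Memory n p E T f g) (hs : f 7 = s) :
    ∃ t ≤ 78 * n + 4, ∃ C l' K' E' T' f' g', Reaches scanProgram ⟨26, f, g⟩ t ⟨71, f', g'⟩ ∧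
      ScanMemory n p E' T' s l' n f' g' ∧ Slab p n s K' C D ∧ ConcaveBelow p s C n ∧
      (0 < n → 0 ∈ C ∧ n - 1 ∈ C) ∧ ListsFaces p n K' E' T' ∧ T'.length ≤ B := by
  obtain ⟨f₁, h1, h2⟩ := reaches_scan hM hs
  obtain ⟨t, ht, l', K', E', T', f', g', h3, h4, h5⟩ := reaches_scan_loop hx hB (2 * n) [] 0 K E T
    f₁ g (by simp) (.init hslab hlists hT) h2
  exact ⟨2 + t, by omega, _, l', K', E', T', f', g', h1.trans h3, h5, h4.slab, h4.concave, h4.ends,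
    h4.lists, by have := h4.count; omega⟩

theorem HaltsIn.of_reaches {prog : Program} {c c' c'' : Config} {t t' : ℕ}
    (h : Reaches prog c t c') (h' : HaltsIn prog c' t' c'') : HaltsIn prog c (t + t') c'' := by
  obtain ⟨r, rfl, h1, h2⟩ := h'
  exact ⟨t + r, by omega, h.trans h1, h2⟩

theorem exists_haltsIn_triangulation (hx : ∀ i j, i < j → j < n → p i 0 < p j 0)
    (hf : ∀ k, f k = if k = 0 then (n : ℤ) else 0)
    (hg : ∀ i < n, g (2 * i) = p i 0 ∧ g (2 * i + 1) = p i 1) :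
    ∃ t ≤ 200 * (n + 1), ∃ K E T f' g', HaltsIn scanProgram ⟨0, f, g⟩ t ⟨75, f', g'⟩ ∧
      IsTriangulation K (p '' Set.Iio n) ∧ ListsFaces p n K E T ∧ Memory n p E T f' g' := by
  obtain ⟨K₀, hK₀⟩ := exists_path_complex hx
  obtain ⟨f₁, r1, m1, hs1, hk1⟩ := reaches_init hf hg
  obtain ⟨t₂, ht₂, f₂, r2, m2, hs2⟩ := reaches_path (n - 1) 0 f₁ (by omega) m1 hk1
  have hslab := path_slab hx hK₀
  obtain ⟨t₃, ht₃, C, l₃, K₃, E₃, T₃, f₃, g₃, r3, m3, hslab3, hC, hendsC, hl3, hT3⟩ :=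
    -- Each scan adds at most `n` triangles, hence the bounds `n` here and `2 * n` for the second
    -- scan.
    reaches_scan_phase (s := 1) (B := n) hx (by omega) (by simpa using hslab)
      (listsFaces_path hx hK₀) (by simp) m2 (hs2.trans hs1)
  obtain ⟨f₄, r4, m4, hs4⟩ := reaches_flip m3
  obtain ⟨t₅, ht₅, C', l₅, K₅, E₅, T₅, f₅, g₅, r5, m5, hslab5, hC', hendsC', hl5, -⟩ :=
    -- The opposite chain is still the whole path, so exchanging the two sides restores the starting
    -- situation of a scan.
    reaches_scan_phase (s := -1) (B := 2 * n) hx le_rfl (by simpa using hslab3.symm) hl3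
      (by omega) m4 hs4
  obtain ⟨f₆, r6, m6⟩ := haltsIn_end m5
  refine ⟨_, ?_, K₅, E₅, T₅, f₆, g₅,
    HaltsIn.of_reaches (r1.trans (r2.trans (r3.trans (r4.trans r5)))) r6, ?_, hl5, m6⟩
  -- The parts add up to at most 166 n + 34 steps.
  · omega
  · refine hslab5.isTriangulation hx hC' (by simpa using hC) fun hn => ?_
    exact ⟨(hendsC' hn).1, (hendsC' hn).2, (hendsC hn).1, (hendsC hn).2⟩

end

/-! ## Input and output -/

theorem bijOn_reverse_get {α β : Type*} {L : List α} {φ : α → β} {S : Set β}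
    (hL : (L.map φ).Nodup) (hS : ∀ b, b ∈ L.map φ ↔ b ∈ S) :
    Set.BijOn (fun i : Fin L.reverse.length => φ L.reverse[i]) Set.univ S := by
  have hrev : (L.reverse.map φ).Nodup := by
    rw [List.map_reverse, List.nodup_reverse]; exact hL
  refine ⟨?_, ?_, ?_⟩
  · intro i _
    exact (hS _).1 (List.mem_map.2 ⟨_, List.mem_reverse.1 (List.getElem_mem i.2), rfl⟩)
  · intro i _ j _ h
    have := (List.Nodup.getElem_inj_iff hrev (i := i) (j := j) (hi := by simpa using i.2)
      (hj := by simpa using j.2)).1 (by simpa using h)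
    exact Fin.ext this
  · intro b hb
    obtain ⟨a, ha, rfl⟩ := List.mem_map.1 ((hS b).2 hb)
    obtain ⟨i, hi, rfl⟩ := List.getElem_of_mem (List.mem_reverse.2 ha)
    exact ⟨⟨i, hi⟩, trivial, rfl⟩

open Classical in
theorem stores_of_listsFaces {n : ℕ} {A : Fin n → Plane} {p : ℕ → Plane}
    (hp : ∀ i (hi : i < n), p i = A ⟨i, hi⟩) {K : Geometry.SimplicialComplex ℝ Plane}
    {E : List (ℕ × ℕ)} {T : List (ℕ × ℕ × ℕ)} {f : ℕ → ℤ} {g : ℕ → ℝ}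
    (hl : ListsFaces p n K E T) (hM : Memory n p E T f g) : Stores A f K := by
  have hE : ∀ i (hi : i < E.reverse.length), (E.reverse[i]).1 < n ∧ (E.reverse[i]).2 < n :=
    fun i hi => hl.edges_lt _ (List.mem_reverse.1 (List.getElem_mem hi))
  have hT : ∀ i (hi : i < T.reverse.length), (T.reverse[i]).1 < n ∧ (T.reverse[i]).2.1 < n ∧
      (T.reverse[i]).2.2 < n :=
    fun i hi => hl.triangles_lt _ (List.mem_reverse.1 (List.getElem_mem hi))
  refine ⟨E.reverse.length, 40 + 7 * n, T.reverse.length, 40 + n,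
    fun i => ![⟨_, (hE i i.2).1⟩, ⟨_, (hE i i.2).2⟩],
    fun i => ![⟨_, (hT i i.2).1⟩, ⟨_, (hT i i.2).2.1⟩, ⟨_, (hT i i.2).2.2⟩],
    ?_, hM.edgeBase, ?_, hM.triangleBase, ?_, ?_, ?_, ?_⟩
  · rw [hM.numEdges, List.length_reverse]
  · rw [hM.numTriangles, List.length_reverse]
  · intro i j
    obtain ⟨h1, h2⟩ := hM.edges.edge i i.2
    fin_cases j
    · exact h1
    · exact h2
  · intro i j
    obtain ⟨h1, h2, h3⟩ := hM.triangles.triangle i i.2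
    fin_cases j
    · exact h1
    · exact h2
    · exact h3
  · refine (bijOn_reverse_get hl.edges_nodup hl.mem_edges).congr fun i _ => ?_
    ext x
    simp [simplexAt, Fin.exists_fin_two, ← hp, eq_comm]
  · refine (bijOn_reverse_get hl.triangles_nodup hl.mem_triangles).congr fun i _ => ?_
    ext x
    simp [simplexAt, Fin.exists_fin_succ, ← hp, eq_comm]

theorem theorem5p1 :
    ∃ (prog : RealRAM.Program) (C : ℕ),
      ∀ (n : ℕ) (P : Finset Plane), P.card = n →
        GeneralPosition (P : Set Plane) →
        Set.InjOn (fun q : Plane => q 0) (P : Set Plane) →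
        ∀ A : Fin n → Plane, Set.range A = (P : Set Plane) →
          Monotone (fun i => A i 0) →
          ∃ (t : ℕ) (c : RealRAM.Config) (K : Geometry.SimplicialComplex ℝ Plane),
            RealRAM.HaltsIn prog (inputConfig A) t c ∧
            t ≤ C * (n + 1) ∧
            IsTriangulation K (P : Set Plane) ∧
            Stores A c.ints K := by
  refine ⟨scanProgram, 200, fun n P hcard _ hinj A hA hmono => ?_⟩
  have hAinj : Function.Injective A := by
    classical
    have hP : Finset.univ.image A = P := by
      rw [← Finset.coe_inj, Finset.coe_image, Finset.coe_univ, Set.image_univ, hA]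
    have := Finset.card_image_iff.1
      (show (Finset.univ.image A).card = Finset.univ.card by rw [hP, hcard]; simp)
    exact fun i j h => this (by simp) (by simp) h
  -- Distinct abscissas make the sorted array strictly increasing, which is the form in which the
  -- order enters the geometry.
  have hstrict : StrictMono fun i => A i 0 := by
    refine hmono.strictMono_of_injective fun i j h => hAinj (hinj ?_ ?_ h)
    · rw [← hA]; exact ⟨i, rfl⟩
    · rw [← hA]; exact ⟨j, rfl⟩
  -- The default value 0 is harmless, since only indices below `n` matter.
  set p : ℕ → Plane := fun i => if h : i < n then A ⟨i, h⟩ else 0 with hpdef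
  have hp : ∀ i (hi : i < n), p i = A ⟨i, hi⟩ := fun i hi => dif_pos hi
  have hx : ∀ i j, i < j → j < n → p i 0 < p j 0 := by
    intro i j hij hj
    rw [hp i (hij.trans hj), hp j hj]
    exact hstrict hij
  have hrange : p '' Set.Iio n = (P : Set Plane) := by
    rw [← hA]
    ext x
    constructor
    · rintro ⟨i, hi, rfl⟩
      exact ⟨⟨i, hi⟩, (hp i hi).symm⟩
    · rintro ⟨i, rfl⟩
      exact ⟨i, i.2, hp i i.2⟩
  obtain ⟨t, ht, K, E, T, f', g', h1, h2, h3, h4⟩ := exists_haltsIn_triangulation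
    (f := (inputConfig A).ints) (g := (inputConfig A).reals) hx (fun _ => rfl) (by
      intro i hi
      rw [hp i hi]
      constructor
      · have : 2 * i / 2 = i := by omega
        simp [inputConfig, hi]
      · have : (2 * i + 1) / 2 = i := by omega
        simp [inputConfig, this, hi, Nat.add_mod])
  exact ⟨t, _, K, h1, ht, hrange ▸ h2, stores_of_listsFaces hp h3 h4⟩
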